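/- **Setting.** Let $d\ge 1$, $\gamma>0$, and let $b^{E}:\mathbb R^d\to\mathbb R^d$, $b^{I}:\mathbb R^d\times\mathbb R^d\to\mathbb R^d$. For a map $f$ between Euclidean spaces let $|f|_1=\sup_{x\ne y}|f(x)-f(y)|/|x-y|$ be its Lipschitz constant. Assume: (i) $L_I:=|b^{I}|_1<\infty$; (ii) $b^{E}(x)=-Kx+g(x)$ for all $x$, where $K\in\mathbb R^{d\times d}$ is symmetric positive definite with smallest eigenvalue $\kappa$ and largest eigenvalue $L_K$, $L_g:=|g|_1<\infty$, and for some $R\in[0,\infty)$ one has $\langle g(x)-g(x'),x-x'\rangle\le 0$ whenever $|x-x'|\ge R$; (iii) $L_g<\gamma\sqrt{\kappa/2}$; (iv) $\displaystyle L_I\le \mathbf C_0\min\Big\{\tfrac{\gamma\tau}{12}\sqrt{2\kappa}\,\min\{1,2(L_K+L_g)\gamma^{-2}\},\ \tfrac{L_K+L_g}{4}\Big\}$. The constants in (iv) are as follows. Put $\tau=\min\{1/8,\ \gamma^{-2}\kappa/2-\gamma^{-4}L_g^2\}$, $\alpha=2(L_K+L_g)\gamma^{-2}$, and, for $x,v\in\mathbb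 R^d$, $$r_l(x,v)^2=\gamma^{-2}\langle Kx,x\rangle+\tfrac12\gamma^{-2}|v|^2+\tfrac12|(1-2\tau)x+\gamma^{-1}v|^2,\qquad r_s(x,v)=\alpha|x|+|x+\gamma^{-1}v|,$$ $$\epsilon_0=\tfrac12\min\Big\{1,\tfrac{2\alpha\gamma}{3\sqrt{L_K}},\alpha\Big\},\qquad \Delta=r_s-\epsilon_0r_l,\qquad \tilde R=\tfrac1{\tau\gamma^2}\big(8\cdot\mathbf 1_{\{R>0\}}+L_gR^2\big),$$ $$D=\sup_{r_l(x,v)\le\tilde R}\Delta(x,v),\qquad R_1=\sup_{\Delta(x,v)\le D}r_s(x,v),$$ $$\mathbf C_0=e^{-\frac{L_K+L_g}{4}R_1^2}\Big(1+\big(1-e^{-\frac{L_K+L_g}{4}R_1^2}\big)\kappa(L_K+L_g)^{-1}\Big)^{-1}.$$ Let $\mu^*$ be an invariant probability measure, with finite first moment, of the McKean–Vlasov Langevin equation $$dX_t=V_t\,dt,\qquad dV_t=\Big(b^{E}(X_t)+\int b^{I}(X_t,x)\,\mathcal L(X_t)(dx)-\gamma V_t\Big)dt+\sqrt{2\gamma}\,dB_t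 ,$$ that is, the solution started from $\mu^*$ satisfies $\mathcal L(X_t,V_t)=\mu^*$ for all $t\ge0$. Let $\mu^*_X$ be the marginal of $\mu^*$ in the first variable. Consider $$dY_t=U_t\,dt,\qquad dU_t=\Big(b^{E}(Y_t)+\int b^{I}(Y_t,x)\,\mu^*_X(dx)-\gamma U_t\Big)dt+\sqrt{2\gamma}\,dB_t ,\qquad(\ast)$$ with $B$ a standard Brownian motion on $\mathbb R^d$; solutions are continuous adapted processes on a filtered probability space on which $B$ is a Brownian motion relative to the filtration. **Proposition.** For every solution $(Y_t,U_t)$ of $(\ast)$ with $\mathbb E[|Y_0|^2+|U_0|^2]<\infty$ one has $$\sup_{t\ge0}\mathbb E\big[|Y_t|^2+|U_t|^2\big]\le M_2$$ with a constant $M_2\in(0,\infty)$ that depends only on $d,\gamma,L_K,L_g,\kappa$, $\mathbb E[|Y_0|^2+|U_0|^2]$, $R$, $|g(0)|$ and $|b^{I}(0,0)|$. -/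

import Mathlib

open MeasureTheory ProbabilityTheory
open scoped NNReal ENNReal

noncomputable section

namespace LangevinMoment

/-- The space `ℝ^d` with its Euclidean norm and inner product. -/
abbrev E (d : ℕ) : Type := EuclideanSpace ℝ (Fin d)

/-- The Lipschitz constant `|f|₁ = sup_{x ≠ y} |f x - f y| / |x - y|`, with values in `[0, ∞]`. -/
def lipConst {A B : Type*} [EMetricSpace A] [EMetricSpace B] (f : A → B) : ℝ≥0∞ :=
  ⨆ (x : A) (y : A) (_ : x ≠ y), edist (f x) (f y) / edist x y

/-- The linear map `x ↦ K x` of `ℝ^d` given by a matrix `K`. -/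
def act {d : ℕ} (K : Matrix (Fin d) (Fin d) ℝ) : E d →ₗ[ℝ] E d := Matrix.toEuclideanLin K

/-! ### Assumptions on the coefficients -/

/-- The Lipschitz and dissipativity assumption on the external force `bE` and the interaction
force `bI`. The Lipschitz constant of `bI` is taken for the Euclidean norm of `ℝ^d × ℝ^d`, which is
the norm of `WithLp 2 (E d × E d)`. For real matrices `Matrix.PosDef` includes symmetry. -/
structure Dissipative {d : ℕ} (bE : E d → E d) (bI : E d → E d → E d)
    (K : Matrix (Fin d) (Fin d) ℝ) (g : E d → E d) (κ L_K : ℝ) (L_g L_I : ℝ≥0) (R : ℝ) : Prop where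
  lip_bI : lipConst (fun z : WithLp 2 (E d × E d) => bI z.fst z.snd) = L_I
  posDef : K.PosDef
  smallest : IsLeast {l : ℝ | Module.End.HasEigenvalue (act K) l} κ
  largest : IsGreatest {l : ℝ | Module.End.HasEigenvalue (act K) l} L_K
  bE_eq : ∀ x, bE x = -(act K x) + g x
  lip_g : lipConst g = L_g
  R_nonneg : 0 ≤ R
  dissip : ∀ x x' : E d, R ≤ ‖x - x'‖ → inner ℝ (g x - g x') (x - x') ≤ 0

/-! ### The explicit constants of the smallness condition -/

def tau (γ κ L_g : ℝ) : ℝ := min (1 / 8) (κ / (2 * γ ^ 2) - L_g ^ 2 / γ ^ 4)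

def alpha (γ L_K L_g : ℝ) : ℝ := 2 * (L_K + L_g) / γ ^ 2

/-- `r_l(x, v)`, the "large" norm on `ℝ^d × ℝ^d`. -/
def rl {d : ℕ} (K : Matrix (Fin d) (Fin d) ℝ) (γ κ L_g : ℝ) (x v : E d) : ℝ :=
  √((γ ^ 2)⁻¹ * inner ℝ (act K x) x + (1 / 2) * (γ ^ 2)⁻¹ * ‖v‖ ^ 2
    + (1 / 2) * ‖(1 - 2 * tau γ κ L_g) • x + γ⁻¹ • v‖ ^ 2)

/-- `r_s(x, v)`, the "small" norm on `ℝ^d × ℝ^d`. -/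
def rs {d : ℕ} (γ L_K L_g : ℝ) (x v : E d) : ℝ :=
  alpha γ L_K L_g * ‖x‖ + ‖x + γ⁻¹ • v‖

def eps0 (γ L_K L_g : ℝ) : ℝ :=
  (1 / 2) * min 1 (min (2 * alpha γ L_K L_g * γ / (3 * √L_K)) (alpha γ L_K L_g))

/-- `Δ(x, v) = r_s(x, v) - ε₀ r_l(x, v)`. -/
def Delta {d : ℕ} (K : Matrix (Fin d) (Fin d) ℝ) (γ κ L_K L_g : ℝ) (x v : E d) : ℝ :=
  rs γ L_K L_g x v - eps0 γ L_K L_g * rl K γ κ L_g x v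

/-- `R̃ = (τ γ²)⁻¹ (8 · 1_{R > 0} + L_g R²)`. -/
def Rtilde (γ κ L_g R : ℝ) : ℝ :=
  1 / (tau γ κ L_g * γ ^ 2) * ((if 0 < R then 8 else 0) + L_g * R ^ 2)

/-- `D(R̃) = sup {Δ(x, v) : r_l(x, v) ≤ R̃}`. -/
def DRtilde {d : ℕ} (K : Matrix (Fin d) (Fin d) ℝ) (γ κ L_K L_g R : ℝ) : ℝ :=
  sSup {r : ℝ | ∃ x v : E d, rl K γ κ L_g x v ≤ Rtilde γ κ L_g R ∧ r = Delta K γ κ L_K L_g x v}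

/-- `R₁ = sup {r_s(x, v) : Δ(x, v) ≤ D(R̃)}`. -/
def R1 {d : ℕ} (K : Matrix (Fin d) (Fin d) ℝ) (γ κ L_K L_g R : ℝ) : ℝ :=
  sSup {r : ℝ | ∃ x v : E d,
    Delta K γ κ L_K L_g x v ≤ DRtilde K γ κ L_K L_g R ∧ r = rs γ L_K L_g x v}

def C0 {d : ℕ} (K : Matrix (Fin d) (Fin d) ℝ) (γ κ L_K L_g R : ℝ) : ℝ :=
  Real.exp (-((L_K + L_g) / 4 * R1 K γ κ L_K L_g R ^ 2)) *
    (1 + (1 - Real.exp (-((L_K + L_g) / 4 * R1 K γ κ L_K L_g R ^ 2))) * κ * (L_K + L_g)⁻¹)⁻¹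

/-- The upper bound imposed on the Lipschitz constant of the interaction force. -/
def interactionBound {d : ℕ} (K : Matrix (Fin d) (Fin d) ℝ) (γ κ L_K L_g R : ℝ) : ℝ :=
  C0 K γ κ L_K L_g R *
    min (γ * tau γ κ L_g / 12 * √(2 * κ) * min 1 (2 * (L_K + L_g) * (γ ^ 2)⁻¹)) ((L_K + L_g) / 4)

/-! ### The stochastic differential equations -/

section

variable {Ω : Type*} {mΩ : MeasurableSpace Ω} {d : ℕ}

/-- `B` is a standard Brownian motion on `ℝ^d` relative to the filtration `𝓕`: it is adapted, its
coordinates are independent real Brownian motions, and the increments after time `s` are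
independent of `𝓕 s`. -/
structure IsStdBrownian (𝓕 : Filtration ℝ≥0 mΩ) (P : Measure Ω) (B : ℝ≥0 → Ω → E d) : Prop where
  adapted : StronglyAdapted 𝓕 B
  coord : ∀ i, IsBrownianReal (fun t ω => B t ω i) P
  indep_coord : iIndepFun (fun (i : Fin d) ω (t : ℝ≥0) => B t ω i) P
  indep_past : ∀ s t : ℝ≥0, s ≤ t →
    Indep (MeasurableSpace.comap (fun ω => B t ω - B s ω) inferInstance) (𝓕 s) P

/-- `(Y, U)` solves, on the filtered probability space `(Ω, 𝓕, P)` with Brownian motion `B`,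
`dY = U dt`, `dU = (bE(Y) + ∫ bI(Y, x) m_t(dx) - γ U) dt + √(2γ) dB`
for a given flow of measures `m` on `ℝ^d`. The noise is additive, so that the equation is the
pathwise integral equation stated here. -/
structure IsLangevinSolution (γ : ℝ) (bE : E d → E d) (bI : E d → E d → E d)
    (m : ℝ≥0 → Measure (E d)) (𝓕 : Filtration ℝ≥0 mΩ) (P : Measure Ω)
    (B Y U : ℝ≥0 → Ω → E d) : Prop where
  brownian : IsStdBrownian 𝓕 P B
  adapted_pos : StronglyAdapted 𝓕 Y
  adapted_vel : StronglyAdapted 𝓕 U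
  continuous_paths : ∀ᵐ ω ∂P, Continuous (fun t => Y t ω) ∧ Continuous (fun t => U t ω)
  eq_pos : ∀ᵐ ω ∂P, ∀ t : ℝ≥0, Y t ω = Y 0 ω + ∫ s in (0 : ℝ)..t, U s.toNNReal ω
  eq_vel : ∀ᵐ ω ∂P, ∀ t : ℝ≥0, U t ω = U 0 ω
    + (∫ s in (0 : ℝ)..t, (bE (Y s.toNNReal ω) + (∫ x, bI (Y s.toNNReal ω) x ∂(m s.toNNReal))
        - γ • U s.toNNReal ω))
    + √(2 * γ) • B t ω

/-- The McKean--Vlasov equation: the flow of measures is the law of the position itself. -/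
def IsMeanFieldSolution (γ : ℝ) (bE : E d → E d) (bI : E d → E d → E d)
    (𝓕 : Filtration ℝ≥0 mΩ) (P : Measure Ω) (B X V : ℝ≥0 → Ω → E d) : Prop :=
  IsLangevinSolution γ bE bI (fun t => P.map (X t)) 𝓕 P B X V

/-- The Markovian equation: the flow of measures is frozen at the position marginal of `μ`. -/
def IsMarkovSolution (γ : ℝ) (bE : E d → E d) (bI : E d → E d → E d) (μ : Measure (E d × E d))
    (𝓕 : Filtration ℝ≥0 mΩ) (P : Measure Ω) (B Y U : ℝ≥0 → Ω → E d) : Prop :=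
  IsLangevinSolution γ bE bI (fun _ => μ.fst) 𝓕 P B Y U

/-- The second moment `E[|Y_t|² + |U_t|²]`, with values in `[0, ∞]`. -/
def secondMoment (P : Measure Ω) (Y U : ℝ≥0 → Ω → E d) (t : ℝ≥0) : ℝ≥0∞ :=
  ∫⁻ ω, (‖Y t ω‖ₑ ^ 2 + ‖U t ω‖ₑ ^ 2) ∂P

end

/-- `μ` is an invariant probability measure, with finite first moment, of the McKean--Vlasov
equation: the solution started from `μ` has law `μ` at all times. -/
structure IsInvariantMeasure {d : ℕ} (γ : ℝ) (bE : E d → E d) (bI : E d → E d → E d)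
    (μ : Measure (E d × E d)) : Prop where
  isProbabilityMeasure : IsProbabilityMeasure μ
  integrable : Integrable (fun z : E d × E d => ‖z.1‖ + ‖z.2‖) μ
  stationary : ∃ (Ω : Type) (mΩ : MeasurableSpace Ω) (P : Measure Ω) (𝓕 : Filtration ℝ≥0 mΩ)
    (B X V : ℝ≥0 → Ω → E d), IsProbabilityMeasure P ∧ IsMeanFieldSolution γ bE bI 𝓕 P B X V ∧
      ∀ t : ℝ≥0, P.map (fun ω => (X t ω, V t ω)) = μ

end LangevinMoment

end

namespace LangevinMoment

/-! ### The coefficients -/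

/-! The square of `rl`, here `energy`, is a Lyapunov function, and because the noise is additive it
can be used path by path, without stochastic calculus. Let W be the Ornstein–Uhlenbeck process
driven by the same Brownian motion. Then (Y, U - W) solves an ordinary differential equation with
random coefficients, in which W appears only as an extra term in the position equation
(`hasDerivAt_sub_ouPath`).

Along this equation the confining drift dissipates the energy at rate 2τγ, up to a constant coming
from the region |x| ≤ R (`energyDeriv_drift_le`). The interaction and W contribute at most a
multiple of the square root of the energy (`energyDeriv_perturb_le`). Hence √(1 + energy) satisfies
a linear differential inequality with rate τγ/2, and Grönwall bounds it by a decaying initial term,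
a constant and an exponential convolution of |W| (`sqrt_energy_le`). The second moment of W is at
most 20d at all times (`lintegral_norm_ouPath_sq_le`).

The constant still contains L_I times the first moment m of the invariant marginal, on which the
final bound may not depend. For the stationary McKean–Vlasov solution the frozen flow of measures is
its own law, so the same pathwise bound applies to it. Taking expectations and letting t → ∞ removes
the initial value and bounds m by an affine function of L_I m. Smallness of L_I closes this
inequality (`interaction_mul_moment_le`). Squaring the pathwise bound for (Y, U) and integrating
then finishes the proof (`secondMoment_le`). -/

lemma lipschitzWith_of_lipConst_eq {A B : Type*} [MetricSpace A] [MetricSpace B] {f : A → B}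
    {L : ℝ≥0} (h : lipConst f = L) : LipschitzWith L f := by
  intro x y
  rcases eq_or_ne x y with rfl | hxy
  · simp
  · have h1 : edist (f x) (f y) / edist x y ≤ L := by
      rw [← h]
      exact le_iSup_of_le x (le_iSup_of_le y (le_iSup_of_le hxy le_rfl))
    exact (ENNReal.div_le_iff (by simpa using hxy) (edist_ne_top x y)).1 h1

lemma act_isSymmetric {d : ℕ} {K : Matrix (Fin d) (Fin d) ℝ} (hK : K.PosDef) :
    (act K).IsSymmetric :=
  Matrix.isSymmetric_toEuclideanLin_iff.2 hK.isHermitian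

lemma mul_norm_sq_le_inner_act {d : ℕ} {K : Matrix (Fin d) (Fin d) ℝ} (hK : K.PosDef) {κ : ℝ}
    (hκ : IsLeast {l : ℝ | Module.End.HasEigenvalue (act K) l} κ) (x : E d) :
    κ * ‖x‖ ^ 2 ≤ inner ℝ (act K x) x := by
  have hS := act_isSymmetric hK
  have hn : Module.finrank ℝ (E d) = d := finrank_euclideanSpace_fin
  set b := hS.eigenvectorBasis hn
  rw [← b.sum_inner_mul_inner, ← b.sum_sq_norm_inner_right, Finset.mul_sum]
  refine Finset.sum_le_sum fun i _ => ?_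
  have h1 : inner ℝ (act K x) (b i) = hS.eigenvalues hn i * inner ℝ (b i) x := by
    rw [hS x (b i), hS.apply_eigenvectorBasis, real_inner_comm, real_inner_smul_left]
    rfl
  have h2 := hκ.2 (hS.hasEigenvalue_eigenvalues hn i)
  rw [h1, Real.norm_eq_abs, sq_abs, mul_assoc, ← sq]
  exact mul_le_mul_of_nonneg_right h2 (sq_nonneg _)

lemma smallest_pos {d : ℕ} {K : Matrix (Fin d) (Fin d) ℝ} (hK : K.PosDef) {κ : ℝ}
    (hκ : IsLeast {l : ℝ | Module.End.HasEigenvalue (act K) l} κ) : 0 < κ := by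
  obtain ⟨v, hv⟩ := hκ.1.exists_hasEigenvector
  have h0 : v.ofLp ≠ 0 := fun h => hv.2 (by ext i; simp [h])
  have h1 := hK.dotProduct_mulVec_pos h0
  have h2 : inner ℝ (act K v) v = κ * ‖v‖ ^ 2 := by
    rw [hv.apply_eq_smul, real_inner_smul_left, real_inner_self_eq_norm_sq]
  have h3 : inner ℝ (act K v) v = star v.ofLp ⬝ᵥ K.mulVec v.ofLp := by
    rw [real_inner_comm, act, EuclideanSpace.inner_eq_star_dotProduct, dotProduct_comm]
    simp
  rw [← h3, h2] at h1
  exact pos_of_mul_pos_left h1 (sq_nonneg _)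

/-- Parseval in an orthonormal eigenbasis. Nonnegativity of the eigenvalues is what lets an upper
bound on them pass to their squares. -/
lemma norm_act_le {d : ℕ} {K : Matrix (Fin d) (Fin d) ℝ} (hK : K.PosDef) {L : ℝ}
    (hL : IsGreatest {l : ℝ | Module.End.HasEigenvalue (act K) l} L)
    (hpos : ∀ l, Module.End.HasEigenvalue (act K) l → 0 ≤ l) (x : E d) :
    ‖act K x‖ ≤ L * ‖x‖ := by
  have hS := act_isSymmetric hK
  have hn : Module.finrank ℝ (E d) = d := finrank_euclideanSpace_fin
  set b := hS.eigenvectorBasis hn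
  refine abs_le_of_sq_le_sq' ?_ (mul_nonneg (hpos _ hL.1) (norm_nonneg _)) |>.2
  rw [mul_pow, ← b.sum_sq_norm_inner_right, ← b.sum_sq_norm_inner_right x, Finset.mul_sum]
  refine Finset.sum_le_sum fun i _ => ?_
  have h1 : inner ℝ (b i) (act K x) = hS.eigenvalues hn i * inner ℝ (b i) x := by
    rw [← hS (b i) x, hS.apply_eigenvectorBasis, real_inner_smul_left]
    rfl
  have h2 := hS.hasEigenvalue_eigenvalues hn i
  rw [h1, norm_mul, mul_pow, Real.norm_eq_abs, sq_abs]
  exact mul_le_mul_of_nonneg_right (pow_le_pow_left₀ (hpos _ h2) (hL.2 h2) 2) (sq_nonneg _)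

/-! ### The energy -/

section Energy

variable {H : Type*} [NormedAddCommGroup H] [InnerProductSpace ℝ H]

/-- The square of the large norm, for an arbitrary force `A` and parameter `τ`. -/
noncomputable def energy (A : H →L[ℝ] H) (γ τ : ℝ) (x v : H) : ℝ :=
  (γ ^ 2)⁻¹ * inner ℝ (A x) x + (1 / 2) * (γ ^ 2)⁻¹ * ‖v‖ ^ 2
    + (1 / 2) * ‖(1 - 2 * τ) • x + γ⁻¹ • v‖ ^ 2

/-- The derivative of the energy in the direction `(x', v')`. -/
noncomputable def energyDeriv (A : H →L[ℝ] H) (γ τ : ℝ) (x v x' v' : H) : ℝ :=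
  2 * (γ ^ 2)⁻¹ * inner ℝ (A x) x' + (γ ^ 2)⁻¹ * inner ℝ v v'
    + inner ℝ ((1 - 2 * τ) • x + γ⁻¹ • v) ((1 - 2 * τ) • x' + γ⁻¹ • v')

lemma hasDerivAt_energy {A : H →L[ℝ] H} (hA : ∀ x y, inner ℝ (A x) y = inner ℝ x (A y))
    (γ τ : ℝ) {x v : ℝ → H} {x' v' : H} {t : ℝ} (hx : HasDerivAt x x' t)
    (hv : HasDerivAt v v' t) :
    HasDerivAt (fun s => energy A γ τ (x s) (v s)) (energyDeriv A γ τ (x t) (v t) x' v') t := by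
  have hAx : HasDerivAt (fun s => A (x s)) (A x') t := A.hasFDerivAt.comp_hasDerivAt t hx
  have h1 := (hAx.inner ℝ hx).const_mul ((γ ^ 2)⁻¹)
  have h2 := hv.norm_sq.const_mul ((1 / 2) * (γ ^ 2)⁻¹)
  have h3 := ((hx.const_smul (1 - 2 * τ)).add (hv.const_smul γ⁻¹)).norm_sq.const_mul (1 / 2 : ℝ)
  refine ((h1.add h2).add h3).congr_deriv ?_
  rw [energyDeriv, hA x' (x t), real_inner_comm (A (x t)) x']
  simp only [Pi.add_apply, Pi.smul_apply]
  ring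

/-- The bounds on the linear force and the parameters under which the energy contracts. -/
structure EnergyBounds (A : H →L[ℝ] H) (γ κ L_K L_g τ : ℝ) : Prop where
  symm : ∀ x y, inner ℝ (A x) y = inner ℝ x (A y)
  lower : ∀ x, κ * ‖x‖ ^ 2 ≤ inner ℝ (A x) x
  upper : ∀ x, ‖A x‖ ≤ L_K * ‖x‖
  gamma_pos : 0 < γ
  kappa_pos : 0 < κ
  L_K_nonneg : 0 ≤ L_K
  tau_pos : 0 < τ
  tau_le : τ ≤ 1 / 8
  tau_le' : τ ≤ κ / (2 * γ ^ 2) - L_g ^ 2 / γ ^ 4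

variable {A : H →L[ℝ] H} {γ κ L_K L_g τ : ℝ}

lemma EnergyBounds.inner_nonneg (hA : EnergyBounds A γ κ L_K L_g τ) (x : H) :
    0 ≤ inner ℝ (A x) x :=
  (mul_nonneg hA.kappa_pos.le (sq_nonneg _)).trans (hA.lower x)

lemma EnergyBounds.energy_nonneg (hA : EnergyBounds A γ κ L_K L_g τ) (x v : H) :
    0 ≤ energy A γ τ x v := by
  have := hA.inner_nonneg x
  rw [energy]; positivity

lemma EnergyBounds.norm_pos_sq_le (hA : EnergyBounds A γ κ L_K L_g τ) (x v : H) :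
    ‖x‖ ^ 2 ≤ γ ^ 2 / κ * energy A γ τ x v := by
  have hγ := hA.gamma_pos
  have hκ := hA.kappa_pos
  have h1 : (γ ^ 2)⁻¹ * (κ * ‖x‖ ^ 2) ≤ energy A γ τ x v := by
    have := mul_le_mul_of_nonneg_left (hA.lower x) (by positivity : 0 ≤ (γ ^ 2)⁻¹)
    have h2 : 0 ≤ (1 / 2) * (γ ^ 2)⁻¹ * ‖v‖ ^ 2
      + (1 / 2) * ‖(1 - 2 * τ) • x + γ⁻¹ • v‖ ^ 2 := by positivity
    rw [energy]; linarith
  calc ‖x‖ ^ 2 = γ ^ 2 / κ * ((γ ^ 2)⁻¹ * (κ * ‖x‖ ^ 2)) := by field_simp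
    _ ≤ _ := mul_le_mul_of_nonneg_left h1 (by positivity)

lemma EnergyBounds.norm_vel_sq_le (hA : EnergyBounds A γ κ L_K L_g τ) (x v : H) :
    ‖v‖ ^ 2 ≤ 2 * γ ^ 2 * energy A γ τ x v := by
  have hγ := hA.gamma_pos
  have h1 : (1 / 2) * (γ ^ 2)⁻¹ * ‖v‖ ^ 2 ≤ energy A γ τ x v := by
    have := hA.inner_nonneg x
    have h2 : 0 ≤ (γ ^ 2)⁻¹ * inner ℝ (A x) x
      + (1 / 2) * ‖(1 - 2 * τ) • x + γ⁻¹ • v‖ ^ 2 := by positivity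
    rw [energy]; linarith
  calc ‖v‖ ^ 2 = 2 * γ ^ 2 * ((1 / 2) * (γ ^ 2)⁻¹ * ‖v‖ ^ 2) := by field_simp
    _ ≤ _ := mul_le_mul_of_nonneg_left h1 (by positivity)

lemma EnergyBounds.energy_le (hA : EnergyBounds A γ κ L_K L_g τ) (x v : H) :
    energy A γ τ x v ≤ ((γ ^ 2)⁻¹ * (L_K + 2) + 1) * (‖x‖ ^ 2 + ‖v‖ ^ 2) := by
  have hγ := hA.gamma_pos
  have hL := hA.L_K_nonneg
  have h1 : inner ℝ (A x) x ≤ L_K * ‖x‖ ^ 2 := by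
    have := real_inner_le_norm (A x) x
    nlinarith [hA.upper x, norm_nonneg x]
  have h2 : ‖(1 - 2 * τ) • x + γ⁻¹ • v‖ ≤ ‖x‖ + γ⁻¹ * ‖v‖ := by
    refine (norm_add_le _ _).trans ?_
    rw [norm_smul, norm_smul, Real.norm_of_nonneg (inv_nonneg.2 hγ.le),
      Real.norm_of_nonneg (by linarith [hA.tau_le])]
    gcongr
    nlinarith [hA.tau_pos, norm_nonneg x]
  have h3 : ‖(1 - 2 * τ) • x + γ⁻¹ • v‖ ^ 2 ≤ 2 * ‖x‖ ^ 2 + 2 * (γ ^ 2)⁻¹ * ‖v‖ ^ 2 := by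
    have := pow_le_pow_left₀ (norm_nonneg _) h2 2
    have h4 := sq_nonneg (‖x‖ - γ⁻¹ * ‖v‖)
    rw [← inv_pow]
    nlinarith
  have hi : 0 ≤ (γ ^ 2)⁻¹ := by positivity
  have h5 := mul_le_mul_of_nonneg_left h1 hi
  have h6 : 0 ≤ (γ ^ 2)⁻¹ * ‖x‖ ^ 2 := by positivity
  have h7 : 0 ≤ (γ ^ 2)⁻¹ * ‖v‖ ^ 2 := by positivity
  have h8 : 0 ≤ (γ ^ 2)⁻¹ * L_K * ‖v‖ ^ 2 := by positivity
  rw [energy]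
  nlinarith [sq_nonneg ‖v‖]

/-- The contraction estimate for the unperturbed drift. -/
lemma EnergyBounds.energyDeriv_drift_le (hA : EnergyBounds A γ κ L_K L_g τ) {x v G : H} {c : ℝ}
    (hG : ‖G‖ ≤ L_g * ‖x‖) (hc : inner ℝ x G ≤ c) (hc0 : 0 ≤ c) :
    energyDeriv A γ τ x v v (-(A x) + G - γ • v) ≤
      -(2 * (τ * γ)) * energy A γ τ x v + γ⁻¹ * c := by
  have hγ := hA.gamma_pos
  have hτ := hA.tau_pos
  have hx := hA.lower x
  -- With δ opaque, every identity below is polynomial modulo the single relation δγ = 1.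
  obtain ⟨δ, hδ⟩ : ∃ δ, δ = γ⁻¹ := ⟨_, rfl⟩
  have hδ0 : 0 < δ := by rw [hδ]; positivity
  have hδγ : δ * γ = 1 := by rw [hδ]; field_simp
  have hsq : (γ ^ 2)⁻¹ = δ ^ 2 := by rw [hδ, inv_pow]
  have hτ' : δ ^ 4 * L_g ^ 2 ≤ δ ^ 2 * κ / 2 - τ := by
    have := hA.tau_le'
    have h1 : κ / (2 * γ ^ 2) - L_g ^ 2 / γ ^ 4 = δ ^ 2 * κ / 2 - δ ^ 4 * L_g ^ 2 := by
      rw [hδ]; field_simp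
    linarith
  -- The mixed terms ⟨Ax, v⟩ cancel, thanks to the weights in the energy. In the twisted component,
  -- friction turns (1 - 2τ)v into -2τv.
  have hD : energyDeriv A γ τ x v v (-(A x) + G - γ • v) =
      -(δ * ‖v‖ ^ 2) - 2 * τ * δ * ‖v‖ ^ 2 - 2 * τ * (1 - 2 * τ) * inner ℝ x v
        - δ * (1 - 2 * τ) * inner ℝ (A x) x + 2 * δ ^ 2 * inner ℝ v G
        + (1 - 2 * τ) * δ * inner ℝ x G := by
    rw [energyDeriv, hsq, ← hδ]
    simp only [inner_add_right, inner_sub_right, inner_add_left, inner_neg_right,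
      real_inner_smul_left, real_inner_smul_right, smul_add, smul_sub, smul_neg,
      real_inner_self_eq_norm_sq, real_inner_comm (A x) v, real_inner_comm (A x) x]
    linear_combination (-(2 * δ) * ‖v‖ ^ 2 - (1 - 2 * τ) * inner ℝ x v) * hδγ
  have hE : energy A γ τ x v = δ ^ 2 * inner ℝ (A x) x + δ ^ 2 * ‖v‖ ^ 2
      + (1 - 2 * τ) * δ * inner ℝ x v + (1 / 2) * (1 - 2 * τ) ^ 2 * ‖x‖ ^ 2 := by
    rw [energy, hsq, ← hδ, ← real_inner_self_eq_norm_sq ((1 - 2 * τ) • x + δ • v)]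
    simp only [inner_add_right, inner_add_left, real_inner_smul_left, real_inner_smul_right,
      real_inner_self_eq_norm_sq, real_inner_comm x v, norm_smul, mul_pow, Real.norm_eq_abs,
      sq_abs]
    ring
  -- Young's inequality, weighted so that the velocity part is exactly the friction term δ‖v‖².
  have hvG : 2 * δ ^ 2 * inner ℝ v G ≤ δ * ‖v‖ ^ 2 + δ ^ 3 * L_g ^ 2 * ‖x‖ ^ 2 := by
    have h1 : inner ℝ v G ≤ ‖v‖ * (L_g * ‖x‖) :=
      (real_inner_le_norm v G).trans (mul_le_mul_of_nonneg_left hG (norm_nonneg _))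
    have h2 : 0 ≤ δ * (‖v‖ - δ * (L_g * ‖x‖)) ^ 2 := by positivity
    have h3 := mul_le_mul_of_nonneg_left h1 (by positivity : 0 ≤ 2 * δ ^ 2)
    linarith
  -- The position part left over from Young is paid for by half of the confinement. The second bound
  -- on τ is what leaves the surplus τγ‖x‖².
  have hLg : δ ^ 3 * L_g ^ 2 * ‖x‖ ^ 2 ≤ δ / 2 * inner ℝ (A x) x - τ * γ * ‖x‖ ^ 2 := by
    have h1 := mul_le_mul_of_nonneg_right hτ' (by positivity : 0 ≤ γ * ‖x‖ ^ 2)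
    have h2 := mul_le_mul_of_nonneg_left hx (by positivity : 0 ≤ δ / 2)
    have h3 : δ ^ 4 * L_g ^ 2 * (γ * ‖x‖ ^ 2) = δ ^ 3 * L_g ^ 2 * ‖x‖ ^ 2 := by
      linear_combination δ ^ 3 * L_g ^ 2 * ‖x‖ ^ 2 * hδγ
    have h4 : (δ ^ 2 * κ / 2 - τ) * (γ * ‖x‖ ^ 2) =
        δ / 2 * (κ * ‖x‖ ^ 2) - τ * γ * ‖x‖ ^ 2 := by
      linear_combination δ * κ / 2 * ‖x‖ ^ 2 * hδγ
    linarith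
  have hcG : (1 - 2 * τ) * δ * inner ℝ x G ≤ δ * c := by
    have h1 : (1 - 2 * τ) * inner ℝ x G ≤ c := by nlinarith [hA.tau_le]
    nlinarith
  -- This amounts to 2τ ≤ (1 - 2τ) - 1/2, that is, τ ≤ 1/8.
  have hK : 2 * τ * δ * inner ℝ (A x) x ≤ δ * (1 - 2 * τ) * inner ℝ (A x) x
      - δ / 2 * inner ℝ (A x) x := by
    have h1 : 0 ≤ δ * inner ℝ (A x) x := mul_nonneg hδ0.le (hA.inner_nonneg x)
    nlinarith [hA.tau_le]
  have hX : τ * γ * (1 - 2 * τ) ^ 2 * ‖x‖ ^ 2 ≤ τ * γ * ‖x‖ ^ 2 := by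
    have h1 : (1 - 2 * τ) ^ 2 ≤ 1 := by nlinarith [hA.tau_le]
    have h2 : 0 ≤ τ * γ * ‖x‖ ^ 2 := by positivity
    nlinarith
  have hR : -(2 * (τ * γ)) * energy A γ τ x v = -(2 * τ * δ * inner ℝ (A x) x)
      - 2 * τ * δ * ‖v‖ ^ 2 - 2 * τ * (1 - 2 * τ) * inner ℝ x v
      - τ * γ * (1 - 2 * τ) ^ 2 * ‖x‖ ^ 2 := by
    rw [hE]
    linear_combination (-(2 * τ) * (δ * inner ℝ (A x) x + δ * ‖v‖ ^ 2
      + (1 - 2 * τ) * inner ℝ x v)) * hδγ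
  rw [hD, hR, ← hδ]
  linarith

/-- The effect of perturbing the direction of differentiation. -/
lemma EnergyBounds.energyDeriv_perturb_le (hA : EnergyBounds A γ κ L_K L_g τ) (x v w Q : H) :
    energyDeriv A γ τ x v w Q ≤ 2 * √(energy A γ τ x v) *
      (γ⁻¹ * ‖Q‖ + (γ⁻¹ * L_K / √κ + 1) * ‖w‖) := by
  have hγ := hA.gamma_pos
  have hκ := hA.kappa_pos
  set r := √(energy A γ τ x v)
  have hr : r ^ 2 = energy A γ τ x v := Real.sq_sqrt (hA.energy_nonneg x v)
  have hr0 : 0 ≤ r := Real.sqrt_nonneg _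
  set y := (1 - 2 * τ) • x + γ⁻¹ • v with hy
  have hx : ‖x‖ ≤ γ / √κ * r := by
    refine abs_le_of_sq_le_sq' ?_ (by positivity) |>.2
    rw [mul_pow, div_pow, Real.sq_sqrt hκ.le, hr]
    exact hA.norm_pos_sq_le x v
  have h0 : (γ⁻¹ * ‖v‖) ^ 2 + ‖y‖ ^ 2 ≤ 2 * r ^ 2 := by
    have h1 : 0 ≤ (γ ^ 2)⁻¹ * inner ℝ (A x) x := mul_nonneg (by positivity) (hA.inner_nonneg x)
    rw [hr, energy, ← hy, mul_pow, inv_pow]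
    linarith
  -- From a² + b² ≤ 2r² one gets (a + b)² ≤ 4r².
  have hv : γ⁻¹ * ‖v‖ + ‖y‖ ≤ 2 * r := by
    refine abs_le_of_sq_le_sq' ?_ (by positivity) |>.2
    nlinarith [sq_nonneg (γ⁻¹ * ‖v‖ - ‖y‖)]
  have hy' : ‖y‖ ≤ 2 * r := by
    have : 0 ≤ γ⁻¹ * ‖v‖ := by positivity
    linarith
  have hAw : 2 * (γ ^ 2)⁻¹ * inner ℝ (A x) w ≤ 2 * r * (γ⁻¹ * L_K / √κ * ‖w‖) := by
    have h1 : inner ℝ (A x) w ≤ L_K * (γ / √κ * r) * ‖w‖ :=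
      (real_inner_le_norm _ _).trans (mul_le_mul_of_nonneg_right ((hA.upper x).trans
        (mul_le_mul_of_nonneg_left hx hA.L_K_nonneg)) (norm_nonneg _))
    refine (mul_le_mul_of_nonneg_left h1 (by positivity)).trans (le_of_eq ?_)
    field_simp
  have hyw : inner ℝ y ((1 - 2 * τ) • w) ≤ 2 * r * ‖w‖ := by
    refine (real_inner_le_norm _ _).trans ?_
    refine mul_le_mul hy' ?_ (norm_nonneg _) (by positivity)
    rw [norm_smul, Real.norm_of_nonneg (by linarith [hA.tau_le])]
    nlinarith [hA.tau_pos, norm_nonneg w]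
  have hQ : (γ ^ 2)⁻¹ * inner ℝ v Q + inner ℝ y (γ⁻¹ • Q) ≤ 2 * r * (γ⁻¹ * ‖Q‖) := by
    have h1 := mul_le_mul_of_nonneg_left (real_inner_le_norm v Q)
      (by positivity : 0 ≤ (γ ^ 2)⁻¹)
    have h2 := mul_le_mul_of_nonneg_left (real_inner_le_norm y Q) (by positivity : 0 ≤ γ⁻¹)
    have h3 := mul_le_mul_of_nonneg_right hv (by positivity : 0 ≤ γ⁻¹ * ‖Q‖)
    have h4 : (γ ^ 2)⁻¹ * (‖v‖ * ‖Q‖) + γ⁻¹ * (‖y‖ * ‖Q‖) =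
        (γ⁻¹ * ‖v‖ + ‖y‖) * (γ⁻¹ * ‖Q‖) := by
      rw [← inv_pow]; ring
    rw [real_inner_smul_right]
    linarith
  rw [energyDeriv, ← hy, inner_add_right]
  linarith

lemma energyDeriv_add (x v x₁ v₁ x₂ v₂ : H) :
    energyDeriv A γ τ x v (x₁ + x₂) (v₁ + v₂) =
      energyDeriv A γ τ x v x₁ v₁ + energyDeriv A γ τ x v x₂ v₂ := by
  simp only [energyDeriv, inner_add_right, smul_add]
  ring

end Energy

/-! ### Pathwise estimates -/

/-- The convolution of a real function with an exponential kernel. -/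
noncomputable def expConv (k : ℝ) (a : ℝ → ℝ) (t : ℝ) : ℝ :=
  ∫ s in (0 : ℝ)..t, Real.exp (-(k * (t - s))) * a s

lemma expConv_eq (k : ℝ) (a : ℝ → ℝ) (t : ℝ) :
    expConv k a t = Real.exp (-(k * t)) * ∫ s in (0 : ℝ)..t, Real.exp (k * s) * a s := by
  rw [expConv, ← intervalIntegral.integral_const_mul]
  congr 1 with s
  rw [← mul_assoc, ← Real.exp_add]
  congr 2; ring

lemma expConv_const {k : ℝ} (hk : 0 < k) (c t : ℝ) :
    expConv k (fun _ => c) t = c / k * (1 - Real.exp (-(k * t))) := by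
  have h1 : ∀ s ∈ Set.uIcc 0 t, HasDerivAt (fun s => Real.exp (k * s) * (c / k))
      (Real.exp (k * s) * c) s := by
    intro s _
    have h2 : HasDerivAt (fun s => k * s) k s := by simpa using (hasDerivAt_id s).const_mul k
    refine ((h2.exp).mul_const (c / k)).congr_deriv ?_
    field_simp
  rw [expConv_eq, intervalIntegral.integral_eq_sub_of_hasDerivAt h1
    (Continuous.intervalIntegrable (by fun_prop) _ _), mul_sub]
  rw [← mul_assoc, ← Real.exp_add]
  simp
  ring

lemma expConv_const_le {k c t : ℝ} (hk : 0 < k) (hc : 0 ≤ c) :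
    expConv k (fun _ => c) t ≤ c / k := by
  rw [expConv_const hk]
  exact mul_le_of_le_one_right (by positivity) (by linarith [Real.exp_pos (-(k * t))])

lemma expConv_nonneg {k t : ℝ} {a : ℝ → ℝ} (ha : ∀ s, 0 ≤ a s) (ht : 0 ≤ t) :
    0 ≤ expConv k a t :=
  intervalIntegral.integral_nonneg ht fun s _ => mul_nonneg (Real.exp_pos _).le (ha s)

/-- Grönwall: exp(kt) h(t) minus the primitive of exp(ks) a(s) is nonincreasing. The derivative is
asked for only at t > 0, with continuity at 0, because the paths used later are extended by
constants to negative times and may have a kink at 0. -/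
lemma le_exp_mul_add_expConv {k : ℝ} {h h' a : ℝ → ℝ} (hc : Continuous h) (ha : Continuous a)
    (hd : ∀ t, 0 < t → HasDerivAt h (h' t) t) (hle : ∀ t, 0 < t → h' t ≤ -k * h t + a t)
    {t : ℝ} (ht : 0 ≤ t) :
    h t ≤ Real.exp (-(k * t)) * h 0 + expConv k a t := by
  have hac : Continuous fun s => Real.exp (k * s) * a s := by fun_prop
  set φ : ℝ → ℝ := fun t => Real.exp (k * t) * h t - ∫ s in (0 : ℝ)..t, Real.exp (k * s) * a s
    with hφ
  have hφc : Continuous φ := by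
    have := intervalIntegral.continuous_primitive
      (fun a b => hac.intervalIntegrable (μ := volume) a b) 0
    fun_prop
  have hφd : ∀ t, 0 < t → HasDerivAt φ
      (Real.exp (k * t) * k * h t + Real.exp (k * t) * h' t - Real.exp (k * t) * a t) t := by
    intro t ht
    have h2 : HasDerivAt (fun s => k * s) k t := by simpa using (hasDerivAt_id t).const_mul k
    exact (h2.exp.mul (hd t ht)).sub
      (intervalIntegral.integral_hasDerivAt_right (hac.intervalIntegrable _ _)
        (hac.stronglyMeasurableAtFilter _ _) hac.continuousAt)
  have hanti : AntitoneOn φ (Set.Ici 0) := by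
    refine antitoneOn_of_deriv_nonpos (convex_Ici 0) hφc.continuousOn ?_ ?_
    · intro s hs
      rw [interior_Ici] at hs
      exact (hφd s hs).differentiableAt.differentiableWithinAt
    · intro s hs
      rw [interior_Ici] at hs
      rw [(hφd s hs).deriv]
      have := mul_le_mul_of_nonneg_left (hle s hs) (Real.exp_pos (k * s)).le
      linarith
  have h1 : φ t ≤ φ 0 := hanti (Set.mem_Ici.2 le_rfl) (Set.mem_Ici.2 ht) ht
  simp only [hφ, mul_zero, Real.exp_zero, one_mul, intervalIntegral.integral_same, sub_zero] at h1
  have h2 := mul_le_mul_of_nonneg_left h1 (Real.exp_pos (-(k * t))).le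
  rw [mul_sub, ← mul_assoc, ← Real.exp_add, neg_add_cancel, Real.exp_zero, one_mul,
    ← expConv_eq] at h2
  linarith

/-! ### The random differential equation obtained by removing the noise -/

section Path

variable {H : Type*} [NormedAddCommGroup H] [InnerProductSpace ℝ H]

lemma continuous_energy (A : H →L[ℝ] H) (γ τ : ℝ) {x v : ℝ → H} (hx : Continuous x)
    (hv : Continuous v) : Continuous fun s => energy A γ τ (x s) (v s) := by
  unfold energy; fun_prop

/-- The Ornstein--Uhlenbeck path `dW = -γ W dt + √(2γ) dβ`, `W 0 = √(2γ) β 0`. -/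
noncomputable def ouPath (γ : ℝ) (β : ℝ → H) (t : ℝ) : H :=
  √(2 * γ) • (β t - γ • ∫ s in (0 : ℝ)..t, Real.exp (-(γ * (t - s))) • β s)

lemma ouPath_eq (γ : ℝ) (β : ℝ → H) (t : ℝ) :
    ouPath γ β t = √(2 * γ) • (β t -
      (γ * Real.exp (-(γ * t))) • ∫ s in (0 : ℝ)..t, Real.exp (γ * s) • β s) := by
  rw [ouPath, mul_smul, ← intervalIntegral.integral_smul (Real.exp (-(γ * t)))]
  congr 5 with s
  rw [smul_smul, ← Real.exp_add]
  congr 2; ring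

lemma continuous_ouPath {γ : ℝ} {β : ℝ → H} (hβ : Continuous β) : Continuous (ouPath γ β) := by
  have hc : Continuous fun s => Real.exp (γ * s) • β s := by fun_prop
  have h1 := intervalIntegral.continuous_primitive
    (fun a b => hc.intervalIntegrable (μ := volume) a b) 0
  rw [show ouPath γ β = _ from funext (ouPath_eq γ β)]
  fun_prop

variable [CompleteSpace H] {γ : ℝ} {β y U F : ℝ → H}

lemma hasDerivAt_of_integral_eq {f f' : ℝ → H} {c : H} (hf' : Continuous f')
    (h : ∀ t, 0 ≤ t → f t = c + ∫ s in (0 : ℝ)..t, f' s) {t : ℝ} (ht : 0 < t) :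
    HasDerivAt f (f' t) t := by
  have h1 : HasDerivAt (fun t => c + ∫ s in (0 : ℝ)..t, f' s) (f' t) t :=
    (intervalIntegral.integral_hasDerivAt_right (hf'.intervalIntegrable _ _)
      (hf'.stronglyMeasurableAtFilter _ _) hf'.continuousAt).const_add c
  refine h1.congr_of_eventuallyEq ?_
  filter_upwards [lt_mem_nhds ht] with s hs using h s hs.le

/-- Subtracting the Ornstein--Uhlenbeck path from the velocity leaves a differentiable path. -/
lemma hasDerivAt_sub_ouPath (hβ : Continuous β) (hU : Continuous U) (hF : Continuous F)
    (hUeq : ∀ t, 0 ≤ t → U t = U 0 + (∫ s in (0 : ℝ)..t, (F s - γ • U s)) + √(2 * γ) • β t)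
    {t : ℝ} (ht : 0 < t) :
    HasDerivAt (fun s => U s - ouPath γ β s) (F t - γ • (U t - ouPath γ β t)) t := by
  have hc : Continuous fun s => F s - γ • U s := by fun_prop
  have hc' : Continuous fun s => Real.exp (γ * s) • β s := by fun_prop
  -- The terms √(2γ) β of U and W cancel, so U - W is a primitive plus a smooth factor times a
  -- primitive, although neither U nor W need be differentiable.
  have h1 : HasDerivAt (fun t => U 0 + ∫ s in (0 : ℝ)..t, (F s - γ • U s)) (F t - γ • U t) t :=
    hasDerivAt_of_integral_eq hc (fun _ _ => rfl) ht
  have h2 : HasDerivAt (fun t => ∫ s in (0 : ℝ)..t, Real.exp (γ * s) • β s)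
      (Real.exp (γ * t) • β t) t :=
    intervalIntegral.integral_hasDerivAt_right (hc'.intervalIntegrable _ _)
      (hc'.stronglyMeasurableAtFilter _ _) hc'.continuousAt
  have h3 : HasDerivAt (fun s => -(γ * s)) (-γ) t := by
    simpa using! ((hasDerivAt_id t).const_mul γ).neg
  have h4 := (((h3.exp.const_mul γ).smul h2).const_smul √(2 * γ))
  have h5 := h1.add h4
  refine (h5.congr_of_eventuallyEq ?_).congr_deriv ?_
  · filter_upwards [lt_mem_nhds ht] with s hs
    simp only [Pi.add_apply, Pi.smul_apply, Pi.smul_apply']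
    rw [hUeq s hs.le, ouPath_eq, smul_sub]
    abel
  · have h6 : (γ * Real.exp (-(γ * t))) • Real.exp (γ * t) • β t = γ • β t := by
      rw [smul_smul, mul_assoc, ← Real.exp_add, neg_add_cancel, Real.exp_zero, mul_one]
    rw [h6, ouPath_eq]
    module

variable {A : H →L[ℝ] H} {κ L_K L_g τ : ℝ}

/-- The pathwise bound on the energy of a solution with its noise subtracted. -/
lemma EnergyBounds.sqrt_energy_le (hA : EnergyBounds A γ κ L_K L_g τ) {G Q : ℝ → H} {c q L_I : ℝ}
    (hβ : Continuous β) (hy : Continuous y) (hU : Continuous U) (hF : Continuous F)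
    (hyeq : ∀ t, 0 ≤ t → y t = y 0 + ∫ s in (0 : ℝ)..t, U s)
    (hUeq : ∀ t, 0 ≤ t → U t = U 0 + (∫ s in (0 : ℝ)..t, (F s - γ • U s)) + √(2 * γ) • β t)
    (hFeq : ∀ t, F t = -(A (y t)) + G t + Q t)
    (hG : ∀ t, ‖G t‖ ≤ L_g * ‖y t‖) (hGc : ∀ t, inner ℝ (y t) (G t) ≤ c) (hc : 0 ≤ c)
    (hQ : ∀ t, ‖Q t‖ ≤ q + L_I * ‖y t‖) (hq : 0 ≤ q)
    (hLI : L_I ≤ τ * γ / 2 * √κ) {t : ℝ} (ht : 0 ≤ t) :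
    √(1 + energy A γ τ (y t) (U t - ouPath γ β t)) ≤
      Real.exp (-(τ * γ / 2 * t)) * √(1 + energy A γ τ (y 0) (U 0 - ouPath γ β 0))
        + (τ * γ + γ⁻¹ * c / 2 + γ⁻¹ * q) / (τ * γ / 2)
        + (γ⁻¹ * L_K / √κ + 1) * expConv (τ * γ / 2) (fun s => ‖ouPath γ β s‖) t := by
  have hγ := hA.gamma_pos
  have hτ := hA.tau_pos
  have hκ := hA.kappa_pos
  have hW := continuous_ouPath (γ := γ) hβ
  set W := ouPath γ β with hWdef
  set e : ℝ → ℝ := fun s => energy A γ τ (y s) (U s - W s) with he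
  have he0 : ∀ s, 0 ≤ e s := fun s => hA.energy_nonneg _ _
  have hec : Continuous e := continuous_energy A γ τ hy (hU.sub hW)
  -- Sources of the three terms: energy = h² - 1 with h = √(1 + energy), the constant in the
  -- dissipation estimate, and the bounded part of Q. Division by 2h and h ≥ 1 give these
  -- coefficients.
  set C := τ * γ + γ⁻¹ * c / 2 + γ⁻¹ * q with hC
  set C_W := γ⁻¹ * L_K / √κ + 1 with hC_W
  have hCW0 : 0 ≤ C_W := by have := hA.L_K_nonneg; positivity
  set e' : ℝ → ℝ := fun t => energyDeriv A γ τ (y t) (U t - W t) (U t)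
    (F t - γ • (U t - W t)) with he'
  have hed : ∀ t, 0 < t → HasDerivAt e (e' t) t := fun t ht =>
    hasDerivAt_energy hA.symm γ τ (hasDerivAt_of_integral_eq hU hyeq ht)
      (hasDerivAt_sub_ouPath hβ hU hF hUeq ht)
  -- The added 1 keeps the square root differentiable where the energy vanishes.
  have hsd : ∀ t, 0 < t → HasDerivAt (fun s => √(1 + e s)) (e' t / (2 * √(1 + e t))) t :=
    fun t ht => ((hed t ht).const_add 1).sqrt (by have := he0 t; positivity)
  have hle : ∀ t, e' t / (2 * √(1 + e t)) ≤
      -(τ * γ / 2) * √(1 + e t) + (C + C_W * ‖W t‖) := by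
    intro t
    set r := √(e t) with hr
    set h := √(1 + e t) with hh
    have hr2 : r ^ 2 = e t := Real.sq_sqrt (he0 t)
    have hh2 : h ^ 2 = 1 + e t := Real.sq_sqrt (by linarith [he0 t])
    have hr0 : 0 ≤ r := Real.sqrt_nonneg _
    have hrh : r ≤ h := Real.sqrt_le_sqrt (by linarith)
    have h1h : 1 ≤ h := by
      rw [hh, Real.one_le_sqrt]; linarith [he0 t]
    have hyr : ‖y t‖ ≤ γ / √κ * r := by
      refine abs_le_of_sq_le_sq' ?_ (by positivity) |>.2
      rw [mul_pow, div_pow, Real.sq_sqrt hκ.le, hr2]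
      exact hA.norm_pos_sq_le _ _
    -- The linear growth of the interaction uses up τγ/2 of the available rate τγ. The other half is
    -- the decay rate that remains.
    have hQr : γ⁻¹ * ‖Q t‖ ≤ γ⁻¹ * q + τ * γ / 2 * h := by
      have h1 : L_I * ‖y t‖ ≤ τ * γ / 2 * √κ * (γ / √κ * h) :=
        mul_le_mul hLI (hyr.trans (by gcongr)) (norm_nonneg _) (by positivity)
      have h2 : γ⁻¹ * (τ * γ / 2 * √κ * (γ / √κ * h)) = τ * γ / 2 * h := by field_simp
      rw [← h2, ← mul_add]
      exact mul_le_mul_of_nonneg_left ((hQ t).trans (by linarith)) (by positivity)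
    have hmain : e' t ≤ -(2 * (τ * γ)) * e t + γ⁻¹ * c
        + 2 * r * (γ⁻¹ * ‖Q t‖ + C_W * ‖W t‖) := by
      have h1 := hA.energyDeriv_drift_le (v := U t - W t) (hG t) (hGc t) hc
      have h2 := hA.energyDeriv_perturb_le (y t) (U t - W t) (W t) (Q t)
      have h3 := energyDeriv_add (A := A) (γ := γ) (τ := τ) (y t) (U t - W t) (U t - W t)
        (-(A (y t)) + G t - γ • (U t - W t)) (W t) (Q t)
      have h4 : -(A (y t)) + G t - γ • (U t - W t) + Q t = F t - γ • (U t - W t) := by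
        rw [hFeq]; abel
      rw [h4, sub_add_cancel] at h3
      rw [show e' t = _ from h3]
      exact add_le_add h1 h2
    rw [div_le_iff₀ (by positivity)]
    have hcγ : γ⁻¹ * c ≤ γ⁻¹ * c * h := le_mul_of_one_le_right (by positivity) h1h
    have hτγ : τ * γ ≤ τ * γ * h := le_mul_of_one_le_right (by positivity) h1h
    have h5 : 2 * r * (γ⁻¹ * ‖Q t‖ + C_W * ‖W t‖) ≤
        2 * h * (γ⁻¹ * q + τ * γ / 2 * h + C_W * ‖W t‖) :=
      mul_le_mul (by linarith) (by linarith) (by positivity) (by positivity)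
    have h6 : -(2 * (τ * γ)) * e t = -(2 * (τ * γ)) * h ^ 2 + 2 * (τ * γ) := by rw [hh2]; ring
    rw [h6] at hmain
    rw [hC]
    nlinarith
  have hfin := le_exp_mul_add_expConv (k := τ * γ / 2) (h := fun s => √(1 + e s))
    (a := fun s => C + C_W * ‖W s‖) (by fun_prop) (by fun_prop) hsd (fun t _ => hle t) ht
  have hsplit : expConv (τ * γ / 2) (fun s => C + C_W * ‖W s‖) t =
      expConv (τ * γ / 2) (fun _ => C) t + C_W * expConv (τ * γ / 2) (fun s => ‖W s‖) t := by
    simp only [expConv, mul_add]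
    rw [intervalIntegral.integral_add (Continuous.intervalIntegrable (by fun_prop) _ _)
      (Continuous.intervalIntegrable (by fun_prop) _ _), ← intervalIntegral.integral_const_mul]
    congr 2 with s
    ring
  have hCle := expConv_const_le (t := t) (by positivity : 0 < τ * γ / 2)
    (by positivity : 0 ≤ C)
  rw [hsplit] at hfin
  linarith

end Path

/-! ### Moments of processes with continuous paths -/

/-- Cauchy–Schwarz for a kernel of mass at most 1/k, obtained by expanding the nonnegative
convolution of (φ - kI)², where I is the convolution of φ. -/
lemma sq_expConv_le {k t : ℝ} (hk : 0 < k) (ht : 0 ≤ t) {φ : ℝ → ℝ} (hφ : Continuous φ) :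
    expConv k φ t ^ 2 ≤ k⁻¹ * expConv k (fun s => φ s ^ 2) t := by
  set I := expConv k φ t with hI
  have h0 : 0 ≤ expConv k (fun s => (φ s - k * I) ^ 2) t :=
    expConv_nonneg (fun s => sq_nonneg _) ht
  have h1 : expConv k (fun s => (φ s - k * I) ^ 2) t = expConv k (fun s => φ s ^ 2) t
      - 2 * k * I * I + (k * I) ^ 2 * expConv k (fun _ => 1) t := by
    have h2 : expConv k (fun s => (φ s - k * I) ^ 2) t = expConv k (fun s => φ s ^ 2) t
        - 2 * k * I * expConv k φ t + (k * I) ^ 2 * expConv k (fun _ => 1) t := by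
      simp only [expConv]
      rw [← intervalIntegral.integral_const_mul, ← intervalIntegral.integral_const_mul,
        ← intervalIntegral.integral_sub (Continuous.intervalIntegrable (by fun_prop) _ _)
        (Continuous.intervalIntegrable (by fun_prop) _ _),
        ← intervalIntegral.integral_add (Continuous.intervalIntegrable (by fun_prop) _ _)
        (Continuous.intervalIntegrable (by fun_prop) _ _)]
      congr 1 with s
      ring
    rw [h2, ← hI]
  have h3 := expConv_const_le (t := t) hk zero_le_one
  have h4 : (k * I) ^ 2 * expConv k (fun _ => 1) t ≤ k * I ^ 2 := by
    refine (mul_le_mul_of_nonneg_left h3 (sq_nonneg _)).trans (le_of_eq ?_)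
    field_simp
  rw [inv_mul_eq_div, le_div_iff₀ hk]
  linarith

section Moments

variable {Ω : Type*} {mΩ : MeasurableSpace Ω} {P : Measure Ω}

lemma measurable_expConv {k : ℝ} {Φ : ℝ → Ω → ℝ} (hm : ∀ t, Measurable (Φ t))
    (hc : ∀ ω, Continuous fun t => Φ t ω) (t : ℝ) :
    Measurable fun ω => expConv k (fun s => Φ s ω) t := by
  have h1 : Measurable (Function.uncurry fun s ω => Real.exp (-(k * (t - s))) * Φ s ω) :=
    measurable_uncurry_of_continuous_of_measurable (fun ω => by have := hc ω; fun_prop)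
      (fun s => (hm s).const_mul _)
  unfold expConv intervalIntegral
  exact (h1.stronglyMeasurable.integral_prod_left).measurable.sub
    (h1.stronglyMeasurable.integral_prod_left).measurable

/-- Tonelli, together with the bound 1/k on the mass of the kernel, which makes the estimate uniform
in t. -/
lemma lintegral_expConv_le [SFinite P] {k c t : ℝ} (hk : 0 < k) (hc0 : 0 ≤ c) (ht : 0 ≤ t)
    {Φ : ℝ → Ω → ℝ} (hm : ∀ t, Measurable (Φ t)) (hc : ∀ ω, Continuous fun t => Φ t ω)
    (h0 : ∀ t ω, 0 ≤ Φ t ω)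
    (hb : ∀ s, 0 ≤ s → s ≤ t → ∫⁻ ω, ENNReal.ofReal (Φ s ω) ∂P ≤ ENNReal.ofReal c) :
    ∫⁻ ω, ENNReal.ofReal (expConv k (fun s => Φ s ω) t) ∂P ≤ ENNReal.ofReal (c / k) := by
  have hrepr : ∀ φ : ℝ → ℝ, Continuous φ → (∀ s, 0 ≤ φ s) →
      ENNReal.ofReal (expConv k φ t) =
        ∫⁻ s in Set.Ioc 0 t, ENNReal.ofReal (Real.exp (-(k * (t - s))) * φ s) := by
    intro φ hφ hφ0
    rw [expConv, intervalIntegral.integral_of_le ht, ofReal_integral_eq_lintegral_ofReal]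
    · exact (Continuous.intervalIntegrable (by fun_prop) 0 t).1
    · exact Filter.Eventually.of_forall fun s => mul_nonneg (Real.exp_pos _).le (hφ0 s)
  have h1 : Measurable (Function.uncurry fun s ω => Real.exp (-(k * (t - s))) * Φ s ω) :=
    measurable_uncurry_of_continuous_of_measurable (fun ω => by have := hc ω; fun_prop)
      (fun s => (hm s).const_mul _)
  calc ∫⁻ ω, ENNReal.ofReal (expConv k (fun s => Φ s ω) t) ∂P
      = ∫⁻ ω, (∫⁻ s in Set.Ioc 0 t, ENNReal.ofReal (Real.exp (-(k * (t - s))) * Φ s ω)) ∂P := by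
        congr 1 with ω
        exact hrepr _ (hc ω) fun s => h0 s ω
    _ = ∫⁻ s in Set.Ioc 0 t, ∫⁻ ω, ENNReal.ofReal (Real.exp (-(k * (t - s))) * Φ s ω) ∂P :=
        (lintegral_lintegral_swap h1.ennreal_ofReal.aemeasurable).symm
    _ ≤ ∫⁻ s in Set.Ioc 0 t, ENNReal.ofReal (Real.exp (-(k * (t - s))) * c) := by
        refine setLIntegral_mono' measurableSet_Ioc fun s hs => ?_
        simp_rw [ENNReal.ofReal_mul (Real.exp_pos _).le]
        rw [lintegral_const_mul _ (hm s).ennreal_ofReal]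
        exact mul_le_mul_right (hb s hs.1.le hs.2) _
    _ = ENNReal.ofReal (expConv k (fun _ => c) t) :=
        (hrepr _ continuous_const fun _ => hc0).symm
    _ ≤ ENNReal.ofReal (c / k) := ENNReal.ofReal_le_ofReal (expConv_const_le hk hc0)

lemma lintegral_sq_expConv_le [SFinite P] {k c t : ℝ} (hk : 0 < k) (hc0 : 0 ≤ c) (ht : 0 ≤ t)
    {Φ : ℝ → Ω → ℝ} (hm : ∀ t, Measurable (Φ t)) (hc : ∀ ω, Continuous fun t => Φ t ω)
    (hb : ∀ s, 0 ≤ s → s ≤ t → ∫⁻ ω, ENNReal.ofReal (Φ s ω ^ 2) ∂P ≤ ENNReal.ofReal c) :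
    ∫⁻ ω, ENNReal.ofReal (expConv k (fun s => Φ s ω) t ^ 2) ∂P ≤ ENNReal.ofReal (c / k ^ 2) := by
  have h1 := lintegral_expConv_le (Φ := fun s ω => Φ s ω ^ 2) hk hc0 ht
    (fun s => (hm s).pow_const 2) (fun ω => (hc ω).pow 2) (fun s ω => sq_nonneg _) hb
  calc ∫⁻ ω, ENNReal.ofReal (expConv k (fun s => Φ s ω) t ^ 2) ∂P
      ≤ ∫⁻ ω, ENNReal.ofReal k⁻¹ *
          ENNReal.ofReal (expConv k (fun s => Φ s ω ^ 2) t) ∂P := by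
        refine lintegral_mono fun ω => ?_
        rw [← ENNReal.ofReal_mul (by positivity)]
        exact ENNReal.ofReal_le_ofReal (sq_expConv_le hk ht (hc ω))
    _ = ENNReal.ofReal k⁻¹ * ∫⁻ ω, ENNReal.ofReal (expConv k (fun s => Φ s ω ^ 2) t) ∂P :=
        lintegral_const_mul' _ _ ENNReal.ofReal_ne_top
    _ ≤ ENNReal.ofReal k⁻¹ * ENNReal.ofReal (c / k) := mul_le_mul_right h1 _
    _ = ENNReal.ofReal (c / k ^ 2) := by
        rw [← ENNReal.ofReal_mul (by positivity)]
        congr 1; field_simp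

/-- A process on `[0, ∞)` with almost surely continuous paths has a version with continuous
paths, extended to `ℝ` by its initial value. -/
lemma exists_continuous_version {H : Type*} [NormedAddCommGroup H] [MeasurableSpace H]
    {B : ℝ≥0 → Ω → H} (hm : ∀ t, Measurable (B t)) (hc : ∀ᵐ ω ∂P, Continuous fun t => B t ω) :
    ∃ β : ℝ → Ω → H, (∀ t, Measurable (β t)) ∧ (∀ ω, Continuous fun t => β t ω) ∧
      ∀ᵐ ω ∂P, ∀ t : ℝ, β t ω = B t.toNNReal ω := by
  classical
  -- Paths are replaced by 0 on a measurable null set containing all discontinuous ones;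
  -- measurability of the set keeps each β t measurable.
  obtain ⟨N, hN, hNm, hN0⟩ := exists_measurable_superset_of_null (ae_iff.1 hc)
  refine ⟨fun t => Nᶜ.indicator (B t.toNNReal), fun t => (hm _).indicator hNm.compl, fun ω => ?_,
    ?_⟩
  · by_cases hω : ω ∈ N
    · simp [hω, continuous_const]
    · have h1 : Continuous fun t => B t ω := by
        by_contra h
        exact hω (hN h)
      simpa [hω] using! h1.comp continuous_real_toNNReal
  · have : ∀ᵐ ω ∂P, ω ∉ N := measure_eq_zero_iff_ae_notMem.1 hN0
    filter_upwards [this] with ω hω t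
    simp [hω]

/-! ### Second moments of the Ornstein–Uhlenbeck process -/

lemma measurable_ouPath {d : ℕ} {γ : ℝ} {β : ℝ → Ω → E d} (hm : ∀ t, Measurable (β t))
    (hc : ∀ ω, Continuous fun t => β t ω) (t : ℝ) :
    Measurable fun ω => ouPath γ (fun s => β s ω) t := by
  have h1 : Measurable (Function.uncurry fun s ω => Real.exp (-(γ * (t - s))) • β s ω) :=
    measurable_uncurry_of_continuous_of_measurable (fun ω => by have := hc ω; fun_prop)
      (fun s => (hm s).const_smul (Real.exp (-(γ * (t - s)))))
  have h2 : ∀ S : Set ℝ, Measurable fun ω => ∫ s in S, Real.exp (-(γ * (t - s))) • β s ω :=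
    fun S => (h1.stronglyMeasurable.integral_prod_left (μ := volume.restrict S)).measurable
  unfold ouPath intervalIntegral
  exact ((hm t).sub (((h2 _).sub (h2 _)).const_smul γ)).const_smul √(2 * γ)

/-- The second moment of β t itself grows with t, so the path is rewritten through increments: since
γ times the mass of the kernel is 1 - exp(-γt), only exp(-γt) β t and a convolution of β t - β s
remain. The kernel is split into two factors of rate γ/2, one to convolve with and one to damp the
increment. -/
lemma norm_ouPath_sq_le {H : Type*} [NormedAddCommGroup H] [InnerProductSpace ℝ H]
    [CompleteSpace H] {γ t : ℝ} (hγ : 0 < γ) (ht : 0 ≤ t)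
    {β : ℝ → H} (hβ : Continuous β) :
    ‖ouPath γ β t‖ ^ 2 ≤ 4 * γ * (Real.exp (-(γ * t)) ^ 2 * ‖β t‖ ^ 2 +
      γ ^ 2 * expConv (γ / 2) (fun s => Real.exp (-(γ / 2 * (t - s))) * ‖β t - β s‖) t ^ 2) := by
  have h1 : β t - γ • ∫ s in (0 : ℝ)..t, Real.exp (-(γ * (t - s))) • β s =
      Real.exp (-(γ * t)) • β t +
        γ • ∫ s in (0 : ℝ)..t, Real.exp (-(γ * (t - s))) • (β t - β s) := by
    have h2 : (∫ s in (0 : ℝ)..t, Real.exp (-(γ * (t - s))) • (β t - β s)) =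
        expConv γ (fun _ => 1) t • β t - ∫ s in (0 : ℝ)..t, Real.exp (-(γ * (t - s))) • β s := by
      rw [expConv, ← intervalIntegral.integral_smul_const, ← intervalIntegral.integral_sub
        (Continuous.intervalIntegrable (by fun_prop) _ _)
        (Continuous.intervalIntegrable (by fun_prop) _ _)]
      congr 1 with s
      rw [mul_one, smul_sub]
    rw [h2, expConv_const hγ, smul_sub, smul_smul, ← mul_assoc, mul_one_div_cancel hγ.ne', one_mul]
    module
  set J := expConv (γ / 2) (fun s => Real.exp (-(γ / 2 * (t - s))) * ‖β t - β s‖) t with hJ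
  have h3 : ‖∫ s in (0 : ℝ)..t, Real.exp (-(γ * (t - s))) • (β t - β s)‖ ≤ J := by
    rw [hJ, expConv]
    refine (intervalIntegral.norm_integral_le_integral_norm ht).trans (le_of_eq ?_)
    congr 1 with s
    rw [norm_smul, Real.norm_of_nonneg (Real.exp_pos _).le, ← mul_assoc, ← Real.exp_add]
    congr 2; ring
  have h4 : ‖β t - γ • ∫ s in (0 : ℝ)..t, Real.exp (-(γ * (t - s))) • β s‖ ≤
      Real.exp (-(γ * t)) * ‖β t‖ + γ * J := by
    rw [h1]
    refine (norm_add_le _ _).trans ?_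
    rw [norm_smul, norm_smul, Real.norm_of_nonneg (Real.exp_pos _).le, Real.norm_of_nonneg hγ.le]
    gcongr
  rw [ouPath, norm_smul, mul_pow, Real.norm_eq_abs, sq_abs, Real.sq_sqrt (by positivity)]
  have h5 := pow_le_pow_left₀ (norm_nonneg _) h4 2
  have h6 : (Real.exp (-(γ * t)) * ‖β t‖ + γ * J) ^ 2 ≤
      2 * (Real.exp (-(γ * t)) ^ 2 * ‖β t‖ ^ 2 + γ ^ 2 * J ^ 2) := by
    nlinarith [sq_nonneg (Real.exp (-(γ * t)) * ‖β t‖ - γ * J)]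
  nlinarith

lemma mul_exp_neg_le_one (x : ℝ) : x * Real.exp (-x) ≤ 1 := by
  rw [Real.exp_neg, mul_inv_le_iff₀ (Real.exp_pos x), one_mul]
  linarith [Real.add_one_le_exp x]

/-- Increments have second moment at most d(t - s), and x exp(-x) ≤ 1 turns each damped one into
d/γ, uniformly in time. The total is 4γ(d/γ + γ² (d/γ)/(γ/2)²) = 20d. The value is not sharp; only
its independence of t matters. -/
lemma lintegral_norm_ouPath_sq_le [SFinite P] {d : ℕ} {γ t : ℝ} (hγ : 0 < γ) (ht : 0 ≤ t)
    {β : ℝ → Ω → E d} (hm : ∀ t, Measurable (β t)) (hc : ∀ ω, Continuous fun t => β t ω)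
    (hzero : ∀ᵐ ω ∂P, β 0 ω = 0)
    (hinc : ∀ s t, 0 ≤ s → s ≤ t →
      ∫⁻ ω, ENNReal.ofReal (‖β t ω - β s ω‖ ^ 2) ∂P ≤ ENNReal.ofReal (d * (t - s))) :
    ∫⁻ ω, ENNReal.ofReal (‖ouPath γ (fun s => β s ω) t‖ ^ 2) ∂P ≤ ENNReal.ofReal (20 * d) := by
  have h1 : ∫⁻ ω, ENNReal.ofReal (Real.exp (-(γ * t)) ^ 2 * ‖β t ω‖ ^ 2) ∂P ≤
      ENNReal.ofReal (d / γ) := by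
    calc ∫⁻ ω, ENNReal.ofReal (Real.exp (-(γ * t)) ^ 2 * ‖β t ω‖ ^ 2) ∂P
        = ∫⁻ ω, ENNReal.ofReal (Real.exp (-(γ * t)) ^ 2) *
            ENNReal.ofReal (‖β t ω - β 0 ω‖ ^ 2) ∂P := by
          refine lintegral_congr_ae ?_
          filter_upwards [hzero] with ω hω
          rw [hω, sub_zero, ENNReal.ofReal_mul (by positivity)]
      _ ≤ ENNReal.ofReal (Real.exp (-(γ * t)) ^ 2) * ENNReal.ofReal (d * (t - 0)) := by
          rw [lintegral_const_mul' _ _ ENNReal.ofReal_ne_top]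
          exact mul_le_mul_right (hinc 0 t le_rfl ht) _
      _ ≤ ENNReal.ofReal (d / γ) := by
          rw [← ENNReal.ofReal_mul (by positivity)]
          refine ENNReal.ofReal_le_ofReal ?_
          have h2 := mul_exp_neg_le_one (γ * t)
          have h3 : Real.exp (-(γ * t)) ≤ 1 := Real.exp_le_one_iff.2 (by
            have : 0 ≤ γ * t := by positivity
            linarith)
          have h4 : Real.exp (-(γ * t)) ^ 2 * (γ * t) ≤ 1 := by
            have h5 : 0 ≤ γ * t * Real.exp (-(γ * t)) := by positivity
            nlinarith [Real.exp_pos (-(γ * t))]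
          rw [le_div_iff₀ hγ, sub_zero]
          calc _ = d * (Real.exp (-(γ * t)) ^ 2 * (γ * t)) := by ring
            _ ≤ d * 1 := mul_le_mul_of_nonneg_left h4 (by positivity)
            _ = d := mul_one _
  have h2 : ∫⁻ ω, ENNReal.ofReal (expConv (γ / 2)
      (fun s => Real.exp (-(γ / 2 * (t - s))) * ‖β t ω - β s ω‖) t ^ 2) ∂P ≤
        ENNReal.ofReal (d / γ / (γ / 2) ^ 2) := by
    refine lintegral_sq_expConv_le
      (Φ := fun s ω => Real.exp (-(γ / 2 * (t - s))) * ‖β t ω - β s ω‖) (by positivity)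
      (by positivity) ht (fun s => ((hm t).sub (hm s)).norm.const_mul _)
      (fun ω => by have := hc ω; fun_prop) fun s hs hst => ?_
    simp_rw [mul_pow, ENNReal.ofReal_mul (sq_nonneg (Real.exp _))]
    rw [lintegral_const_mul' _ _ ENNReal.ofReal_ne_top]
    refine (mul_le_mul_right (hinc s t hs hst) _).trans ?_
    rw [← ENNReal.ofReal_mul (by positivity)]
    refine ENNReal.ofReal_le_ofReal ?_
    have h3 : Real.exp (-(γ / 2 * (t - s))) ^ 2 = Real.exp (-(γ * (t - s))) := by
      rw [← Real.exp_nat_mul]; congr 1; push_cast; ring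
    rw [h3, le_div_iff₀ hγ]
    calc _ = d * (γ * (t - s) * Real.exp (-(γ * (t - s)))) := by ring
      _ ≤ d * 1 := mul_le_mul_of_nonneg_left (mul_exp_neg_le_one _) (by positivity)
      _ = d := mul_one _
  calc ∫⁻ ω, ENNReal.ofReal (‖ouPath γ (fun s => β s ω) t‖ ^ 2) ∂P
      ≤ ∫⁻ ω, ENNReal.ofReal (4 * γ) *
          (ENNReal.ofReal (Real.exp (-(γ * t)) ^ 2 * ‖β t ω‖ ^ 2) +
          ENNReal.ofReal (γ ^ 2) * ENNReal.ofReal (expConv (γ / 2)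
            (fun s => Real.exp (-(γ / 2 * (t - s))) * ‖β t ω - β s ω‖) t ^ 2)) ∂P := by
        refine lintegral_mono fun ω => ?_
        rw [← ENNReal.ofReal_mul (by positivity), ← ENNReal.ofReal_add (by positivity)
          (by positivity), ← ENNReal.ofReal_mul (by positivity)]
        exact ENNReal.ofReal_le_ofReal (norm_ouPath_sq_le hγ ht (hc ω))
    _ ≤ ENNReal.ofReal (4 * γ) * (ENNReal.ofReal (d / γ) +
          ENNReal.ofReal (γ ^ 2) * ENNReal.ofReal (d / γ / (γ / 2) ^ 2)) := by
        rw [lintegral_const_mul' _ _ ENNReal.ofReal_ne_top, lintegral_add_left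
          (((hm t).norm.pow_const 2).const_mul _).ennreal_ofReal,
          lintegral_const_mul' _ _ ENNReal.ofReal_ne_top]
        gcongr
    _ = ENNReal.ofReal (20 * d) := by
        rw [← ENNReal.ofReal_mul (by positivity), ← ENNReal.ofReal_add (by positivity)
          (by positivity), ← ENNReal.ofReal_mul (by positivity)]
        congr 1
        field_simp
        ring

lemma IsStdBrownian.lintegral_increment [IsProbabilityMeasure P] {d : ℕ}
    {𝓕 : Filtration ℝ≥0 mΩ} {B : ℝ≥0 → Ω → E d} (hB : IsStdBrownian 𝓕 P B) {s t : ℝ≥0}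
    (hst : s ≤ t) :
    ∫⁻ ω, ENNReal.ofReal (‖B t ω - B s ω‖ ^ 2) ∂P = ENNReal.ofReal (d * (t - s)) := by
  have hm : ∀ t, Measurable (B t) := fun t => ((hB.adapted t).mono (𝓕.le t)).measurable
  have hmi : ∀ i t, Measurable fun ω => B t ω i := fun i t => by
    have := hm t; fun_prop
  have h1 : ∀ i, ∫⁻ ω, ENNReal.ofReal ((B t ω i - B s ω i) ^ 2) ∂P = ENNReal.ofReal (t - s) := by
    intro i
    have hl := (hB.coord i).toIsPreBrownianReal.hasLaw_sub t s
    have hmean : ∫ ω, ((fun ω => B t ω i) - fun ω => B s ω i) ω ∂P = 0 := by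
      rw [hl.integral_eq, integral_id_gaussianReal]
    have h2 := evariance_eq_lintegral_ofReal ((fun ω => B t ω i) - fun ω => B s ω i) P
    rw [← ofReal_variance hl.hasGaussianLaw.memLp_two, hl.variance_eq, variance_id_gaussianReal,
      hmean] at h2
    simp only [sub_zero, Pi.sub_apply] at h2
    rw [← h2, coe_nndist, Real.dist_eq]
    congr 1
    exact abs_of_nonneg (sub_nonneg.2 (NNReal.coe_le_coe.2 hst))
  simp_rw [EuclideanSpace.norm_sq_eq, Real.norm_eq_abs, sq_abs, PiLp.sub_apply]
  simp_rw [ENNReal.ofReal_sum_of_nonneg (fun i _ => sq_nonneg _)]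
  have h2 : ∀ i, Measurable fun ω => ENNReal.ofReal ((B t ω i - B s ω i) ^ 2) := fun i =>
    (((hmi i t).sub (hmi i s)).pow_const 2).ennreal_ofReal
  rw [lintegral_finsetSum _ fun i _ => h2 i]
  simp_rw [h1]
  rw [Finset.sum_const, Finset.card_univ, Fintype.card_fin, nsmul_eq_mul,
    ENNReal.ofReal_mul (by positivity), ENNReal.ofReal_natCast]

end Moments

/-! ### Consequences of the assumptions -/

section Coefficients

variable {d : ℕ} {bE : E d → E d} {bI : E d → E d → E d} {K : Matrix (Fin d) (Fin d) ℝ}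
  {g : E d → E d} {γ κ L_K R : ℝ} {L_g L_I : ℝ≥0}

/-- The continuous linear map of a matrix. -/
noncomputable def actL (K : Matrix (Fin d) (Fin d) ℝ) : E d →L[ℝ] E d :=
  LinearMap.toContinuousLinearMap (act K)

lemma Dissipative.energyBounds (h : Dissipative bE bI K g κ L_K L_g L_I R) (hγ : 0 < γ)
    (hLg : (L_g : ℝ) < γ * √(κ / 2)) :
    EnergyBounds (actL K) γ κ L_K L_g (tau γ κ L_g) := by
  have hκ := smallest_pos h.posDef h.smallest
  have hpos : ∀ l, Module.End.HasEigenvalue (act K) l → 0 ≤ l := fun l hl =>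
    hκ.le.trans (h.smallest.2 hl)
  refine ⟨fun x y => act_isSymmetric h.posDef x y,
    fun x => mul_norm_sq_le_inner_act h.posDef h.smallest x,
    fun x => norm_act_le h.posDef h.largest hpos x, hγ, hκ, hpos _ h.largest.1, ?_,
    min_le_left _ _, min_le_right _ _⟩
  -- The strict bound L_g < γ√(κ/2) says precisely that the second entry of the minimum is positive.
  refine lt_min (by norm_num) (sub_pos.2 ?_)
  have h1 : (L_g : ℝ) ^ 2 < γ ^ 2 * (κ / 2) := by
    have := pow_lt_pow_left₀ hLg L_g.2 two_ne_zero
    rwa [mul_pow, Real.sq_sqrt (by positivity)] at this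
  rw [div_lt_div_iff₀ (by positivity) (by positivity)]
  have h2 : 0 < 2 * γ ^ 2 := by positivity
  nlinarith

/-- This is all that is needed from the smallness condition. The factor `C0` lies in [0, 1] whatever
the value of `R1`, which enters only through its square in a nonpositive exponent, and √(2κ) ≤ 2√κ
turns 1/12 into 1/6. -/
lemma Dissipative.interaction_le (h : Dissipative bE bI K g κ L_K L_g L_I R) (hγ : 0 < γ)
    (hLg : (L_g : ℝ) < γ * √(κ / 2)) (hLI : (L_I : ℝ) ≤ interactionBound K γ κ L_K L_g R) :
    (L_I : ℝ) ≤ tau γ κ L_g * γ / 6 * √κ := by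
  have hA := h.energyBounds hγ hLg
  have hτ := hA.tau_pos
  have hκ := hA.kappa_pos
  have hL : 0 ≤ L_K + L_g := add_nonneg hA.L_K_nonneg L_g.2
  have h0 : 0 ≤ C0 K γ κ L_K L_g R ∧ C0 K γ κ L_K L_g R ≤ 1 := by
    set e := Real.exp (-((L_K + L_g) / 4 * R1 K γ κ L_K L_g R ^ 2)) with he
    have he1 : e ≤ 1 := Real.exp_le_one_iff.2 (by
      have : 0 ≤ (L_K + L_g) / 4 * R1 K γ κ L_K L_g R ^ 2 := by positivity
      linarith)
    have he0 : 0 ≤ e := (Real.exp_pos _).le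
    have h1 : 1 ≤ 1 + (1 - e) * κ * (L_K + L_g)⁻¹ := by
      have : 0 ≤ (1 - e) * κ * (L_K + L_g)⁻¹ :=
        mul_nonneg (mul_nonneg (by linarith) hκ.le) (inv_nonneg.2 hL)
      linarith
    rw [C0, ← he]
    exact ⟨mul_nonneg he0 (inv_nonneg.2 (by linarith)),
      mul_le_one₀ he1 (inv_nonneg.2 (by linarith)) (inv_le_one_of_one_le₀ h1)⟩
  set m := min (γ * tau γ κ L_g / 12 * √(2 * κ) * min 1 (2 * (L_K + L_g) * (γ ^ 2)⁻¹))
    ((L_K + L_g) / 4) with hm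
  have hm0 : 0 ≤ m := le_min (by positivity) (by positivity)
  have hm1 : m ≤ γ * tau γ κ L_g / 12 * √(2 * κ) :=
    (min_le_left _ _).trans (mul_le_of_le_one_right (by positivity) (min_le_left _ _))
  have h2 : √(2 * κ) ≤ 2 * √κ := by
    rw [Real.sqrt_le_left (by positivity), mul_pow, Real.sq_sqrt hκ.le]
    linarith
  calc (L_I : ℝ) ≤ C0 K γ κ L_K L_g R * m := hLI
    _ ≤ 1 * m := mul_le_mul_of_nonneg_right h0.2 hm0
    _ ≤ γ * tau γ κ L_g / 12 * √(2 * κ) := by rw [one_mul]; exact hm1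
    _ ≤ γ * tau γ κ L_g / 12 * (2 * √κ) := by gcongr
    _ = _ := by ring

lemma Dissipative.norm_interaction_sub_le (h : Dissipative bE bI K g κ L_K L_g L_I R)
    (y x y' x' : E d) : ‖bI y x - bI y' x'‖ ≤ L_I * (‖y - y'‖ + ‖x - x'‖) := by
  have h1 := (lipschitzWith_of_lipConst_eq h.lip_bI).dist_le_mul (WithLp.toLp 2 (y, x))
    (WithLp.toLp 2 (y', x'))
  rw [dist_eq_norm, WithLp.prod_dist_eq_of_L2] at h1
  refine h1.trans (mul_le_mul_of_nonneg_left ?_ L_I.2)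
  rw [Real.sqrt_le_left (by positivity), ← dist_eq_norm, ← dist_eq_norm]
  change dist y y' ^ 2 + dist x x' ^ 2 ≤ _
  nlinarith [dist_nonneg (x := y) (y := y'), dist_nonneg (x := x) (y := x')]

variable {ν : Measure (E d)} [IsProbabilityMeasure ν]

lemma Dissipative.integrable_interaction (h : Dissipative bE bI K g κ L_K L_g L_I R)
    (hν : Integrable (fun x => ‖x‖) ν) (y : E d) : Integrable (bI y) ν := by
  have hc : LipschitzWith L_I (bI y) := LipschitzWith.of_dist_le_mul fun x x' => by
    simpa [dist_eq_norm] using h.norm_interaction_sub_le y x y x'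
  refine ((hν.const_mul (L_I : ℝ)).add (integrable_const ‖bI y 0‖)).mono'
    hc.continuous.aestronglyMeasurable (Filter.Eventually.of_forall fun x => ?_)
  have h1 := h.norm_interaction_sub_le y x y 0
  have h2 := norm_sub_norm_le (bI y x) (bI y 0)
  simp only [sub_self, norm_zero, zero_add, sub_zero] at h1
  simp only [Pi.add_apply]
  linarith

lemma Dissipative.continuous_meanForce (h : Dissipative bE bI K g κ L_K L_g L_I R)
    (hν : Integrable (fun x => ‖x‖) ν) : Continuous fun y => ∫ x, bI y x ∂ν := by
  refine (LipschitzWith.of_dist_le_mul (K := L_I) fun y y' => ?_).continuous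
  rw [dist_eq_norm, ← integral_sub (h.integrable_interaction hν y)
    (h.integrable_interaction hν y')]
  refine (norm_integral_le_of_norm_le_const (C := L_I * dist y y')
    (Filter.Eventually.of_forall fun x => ?_)).trans (by simp)
  simpa [dist_eq_norm] using h.norm_interaction_sub_le y x y' x

lemma Dissipative.norm_meanForce_le (h : Dissipative bE bI K g κ L_K L_g L_I R)
    (hν : Integrable (fun x => ‖x‖) ν) (y : E d) :
    ‖∫ x, bI y x ∂ν‖ ≤ ‖bI 0 0‖ + L_I * (∫ x, ‖x‖ ∂ν) + L_I * ‖y‖ := by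
  have h0 : Integrable (fun x => ‖bI 0 0‖ + L_I * ‖x‖ + L_I * ‖y‖) ν :=
    ((integrable_const _).add (hν.const_mul _)).add (integrable_const _)
  refine (norm_integral_le_of_norm_le h0 (Filter.Eventually.of_forall fun x => ?_)).trans
    (le_of_eq ?_)
  · have h1 := h.norm_interaction_sub_le y x 0 0
    have h2 := norm_sub_norm_le (bI y x) (bI 0 0)
    simp only [sub_zero] at h1
    linarith
  · have h1 := integral_add (((integrable_const ‖bI 0 0‖).add (hν.const_mul (L_I : ℝ))))
      (integrable_const (L_I * ‖y‖))
    have h2 := integral_add (integrable_const ‖bI 0 0‖) (hν.const_mul (L_I : ℝ))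
    simp only [Pi.add_apply] at h1
    rw [h1, h2, integral_const_mul]
    simp

end Coefficients

/-! ### Bounds for solutions -/

/-- The size of the drift at bounded energy, without the contribution of the interaction. -/
noncomputable def driftConst (γ τ L_g R a b : ℝ) : ℝ :=
  τ * γ + γ⁻¹ * (L_g * R ^ 2) / 2 + γ⁻¹ * (a + b)

/-- The factor with which the noise enters the energy estimate. -/
noncomputable def noiseConst (γ L_K κ : ℝ) : ℝ := γ⁻¹ * L_K / √κ + 1

section Solutions

variable {Ω : Type*} {mΩ : MeasurableSpace Ω} {P : Measure Ω} {d : ℕ} {bE : E d → E d}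
  {bI : E d → E d → E d} {K : Matrix (Fin d) (Fin d) ℝ} {g : E d → E d} {γ κ L_K R : ℝ}
  {L_g L_I : ℝ≥0} {𝓕 : Filtration ℝ≥0 mΩ} {B Y U : ℝ≥0 → Ω → E d}

/-- After subtracting an Ornstein--Uhlenbeck process `W` from the velocity, a solution satisfies
a pathwise bound in terms of a process `J` with bounded second moments. -/
lemma IsLangevinSolution.exists_pathwise_bound [IsProbabilityMeasure P] {ν : Measure (E d)}
    [IsProbabilityMeasure ν] (hν : Integrable (fun x => ‖x‖) ν)
    (sol : IsLangevinSolution γ bE bI (fun _ => ν) 𝓕 P B Y U)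
    (h : Dissipative bE bI K g κ L_K L_g L_I R) {τ : ℝ}
    (hA : EnergyBounds (actL K) γ κ L_K L_g τ) (hLI : (L_I : ℝ) ≤ τ * γ / 2 * √κ) :
    ∃ (W : ℝ≥0 → Ω → E d) (J : ℝ≥0 → Ω → ℝ), (∀ t, Measurable (J t)) ∧ (∀ t ω, 0 ≤ J t ω) ∧
      (∀ t, Measurable (W t)) ∧
      (∀ t, ∫⁻ ω, ENNReal.ofReal (‖W t ω‖ ^ 2) ∂P ≤ ENNReal.ofReal (20 * d)) ∧
      (∀ t, ∫⁻ ω, ENNReal.ofReal (J t ω ^ 2) ∂P ≤ ENNReal.ofReal (20 * d / (τ * γ / 2) ^ 2)) ∧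
      ∀ᵐ ω ∂P, ∀ t : ℝ≥0, √(1 + energy (actL K) γ τ (Y t ω) (U t ω - W t ω)) ≤
        Real.exp (-(τ * γ / 2 * t)) * √(1 + energy (actL K) γ τ (Y 0 ω) (U 0 ω))
          + (driftConst γ τ L_g R ‖g 0‖ ‖bI 0 0‖ + γ⁻¹ * (L_I * ∫ x, ‖x‖ ∂ν)) / (τ * γ / 2)
          + noiseConst γ L_K κ * J t ω := by
  have hγ := hA.gamma_pos
  have hτ := hA.tau_pos
  have hmeas : ∀ {Z : ℝ≥0 → Ω → E d}, StronglyAdapted 𝓕 Z → ∀ t, Measurable (Z t) :=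
    fun hZ t => ((hZ t).mono (𝓕.le t)).measurable
  have hBc : ∀ᵐ ω ∂P, Continuous fun t => B t ω := by
    filter_upwards [ae_all_iff.2 fun i => (sol.brownian.coord i).cont] with ω hω
    exact (PiLp.continuous_toLp 2 _).comp (continuous_pi hω)
  obtain ⟨β, hβm, hβc, hβ⟩ := exists_continuous_version (hmeas sol.brownian.adapted) hBc
  have hβ0 : ∀ᵐ ω ∂P, β 0 ω = 0 := by
    filter_upwards [hβ, ae_all_iff.2 fun i =>
      (sol.brownian.coord i).toIsPreBrownianReal.eval_zero_ae_eq_zero] with ω h1 h2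
    rw [h1, Real.toNNReal_zero]
    ext i
    simpa using h2 i
  have hinc : ∀ s t, 0 ≤ s → s ≤ t →
      ∫⁻ ω, ENNReal.ofReal (‖β t ω - β s ω‖ ^ 2) ∂P ≤ ENNReal.ofReal (d * (t - s)) := by
    intro s t hs hst
    have h1 := sol.brownian.lintegral_increment (Real.toNNReal_le_toNNReal hst)
    rw [Real.coe_toNNReal s hs, Real.coe_toNNReal t (hs.trans hst)] at h1
    rw [← h1]
    refine le_of_eq (lintegral_congr_ae ?_)
    filter_upwards [hβ] with ω hω
    rw [hω, hω]
  have hWm := measurable_ouPath (γ := γ) hβm hβc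
  have hWc : ∀ ω, Continuous fun t => ouPath γ (fun s => β s ω) t :=
    fun ω => continuous_ouPath (hβc ω)
  have hW2 : ∀ t, 0 ≤ t →
      ∫⁻ ω, ENNReal.ofReal (‖ouPath γ (fun s => β s ω) t‖ ^ 2) ∂P ≤ ENNReal.ofReal (20 * d) :=
    fun t ht => lintegral_norm_ouPath_sq_le hγ ht hβm hβc hβ0 hinc
  refine ⟨fun t ω => ouPath γ (fun s => β s ω) t,
    fun t ω => expConv (τ * γ / 2) (fun s => ‖ouPath γ (fun s => β s ω) s‖) t,
    fun t => measurable_expConv (fun s => (hWm s).norm) (fun ω => (hWc ω).norm) t,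
    fun t ω => expConv_nonneg (fun s => norm_nonneg _) t.2, fun t => hWm t, fun t => hW2 t t.2,
    fun t => lintegral_sq_expConv_le (by positivity) (by positivity) t.2
      (fun s => (hWm s).norm) (fun ω => (hWc ω).norm) fun s hs _ => hW2 s hs, ?_⟩
  have hgL := lipschitzWith_of_lipConst_eq h.lip_g
  have hF := h.continuous_meanForce hν
  have hbE : Continuous bE := by
    rw [show bE = _ from funext h.bE_eq]
    exact ((actL K).continuous.neg).add hgL.continuous
  filter_upwards [hβ, hβ0, sol.continuous_paths, sol.eq_pos, sol.eq_vel]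
    with ω hω hω0 hcont hpos hvel t
  have hy : Continuous fun s : ℝ => Y s.toNNReal ω := hcont.1.comp continuous_real_toNNReal
  have hU : Continuous fun s : ℝ => U s.toNNReal ω := hcont.2.comp continuous_real_toNNReal
  have hnorm : ∀ y : E d, ‖g y - g 0‖ ≤ L_g * ‖y‖ := fun y => by
    simpa [dist_eq_norm] using hgL.dist_le_mul y 0
  -- The function g is centred at 0, so that G is bounded by L_g‖y‖ and dissipativity can be tested
  -- against the point 0. The constant g 0 joins the interaction in Q.
  have key := hA.sqrt_energy_le (β := fun s => β s ω) (y := fun s => Y s.toNNReal ω)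
    (U := fun s => U s.toNNReal ω)
    (F := fun s => bE (Y s.toNNReal ω) + ∫ x, bI (Y s.toNNReal ω) x ∂ν)
    (G := fun s => g (Y s.toNNReal ω) - g 0)
    (Q := fun s => g 0 + ∫ x, bI (Y s.toNNReal ω) x ∂ν) (c := L_g * R ^ 2)
    (q := ‖g 0‖ + (‖bI 0 0‖ + L_I * ∫ x, ‖x‖ ∂ν)) (L_I := L_I) (t := t)
    (hβc ω) hy hU ((hbE.comp hy).add (hF.comp hy)) ?_ ?_ ?_ ?_ ?_ ?_ ?_ ?_ hLI t.2
  · have hW0 : ouPath γ (fun s => β s ω) 0 = 0 := by simp [ouPath, hω0]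
    simp only [Real.toNNReal_coe, Real.toNNReal_zero, hW0, sub_zero] at key
    refine key.trans (le_of_eq ?_)
    rw [driftConst, noiseConst]
    ring
  · intro s hs
    simpa [Real.coe_toNNReal s hs] using hpos s.toNNReal
  · intro s hs
    simpa [Real.coe_toNNReal s hs, hω] using hvel s.toNNReal
  · intro s
    rw [h.bE_eq]
    change -(act K _) + _ + _ = -(act K _) + _ + _
    abel
  · exact fun s => hnorm _
  · intro s
    -- Outside the ball of radius R the inner product is nonpositive; inside, the Lipschitz bound
    -- gives at most L_g R².
    rcases le_total R ‖Y s.toNNReal ω‖ with hR | hR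
    · have h1 := h.dissip (Y s.toNNReal ω) 0 (by simpa using hR)
      rw [sub_zero, real_inner_comm] at h1
      exact h1.trans (by positivity)
    · refine (real_inner_le_norm _ _).trans ?_
      calc _ ≤ ‖Y s.toNNReal ω‖ * (L_g * ‖Y s.toNNReal ω‖) := by gcongr; exact hnorm _
        _ = L_g * ‖Y s.toNNReal ω‖ ^ 2 := by ring
        _ ≤ L_g * R ^ 2 := by gcongr
  · positivity
  · intro s
    refine (norm_add_le _ _).trans ?_
    have := h.norm_meanForce_le hν (Y s.toNNReal ω)
    linarith
  · have : 0 ≤ ∫ x, ‖x‖ ∂ν := integral_nonneg fun _ => norm_nonneg _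
    positivity

/-- An upper bound for the expectation of the noise contribution. -/
noncomputable def noiseMean (d : ℕ) (γ τ : ℝ) : ℝ := (20 * d / (τ * γ / 2) ^ 2 + 1) / 2

lemma EnergyBounds.sqrt_one_add_energy_le {τ : ℝ} (hA : EnergyBounds (actL K) γ κ L_K L_g τ)
    (x v : E d) : √(1 + energy (actL K) γ τ x v) ≤
      1 + ((γ ^ 2)⁻¹ * (L_K + 2) + 1) * (‖x‖ + ‖v‖) := by
  have hγ := hA.gamma_pos
  have hL := hA.L_K_nonneg
  have h1 := hA.energy_le x v
  set c := (γ ^ 2)⁻¹ * (L_K + 2) + 1 with hc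
  have hc1 : 1 ≤ c := by
    have : 0 ≤ (γ ^ 2)⁻¹ * (L_K + 2) := by positivity
    linarith
  rw [Real.sqrt_le_left (by positivity)]
  have hx := norm_nonneg x
  have hv := norm_nonneg v
  have h2 : ‖x‖ ^ 2 + ‖v‖ ^ 2 ≤ (‖x‖ + ‖v‖) ^ 2 := by nlinarith
  have h3 : c * (‖x‖ ^ 2 + ‖v‖ ^ 2) ≤ c ^ 2 * (‖x‖ + ‖v‖) ^ 2 := by
    apply mul_le_mul (by nlinarith) h2 (by positivity) (by positivity)
  have h4 : 0 ≤ c * (‖x‖ + ‖v‖) := by positivity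
  nlinarith

/-! ### First moment of the invariant measure -/

lemma IsInvariantMeasure.integrable_norm_fst {μ : Measure (E d × E d)}
    (hμ : IsInvariantMeasure γ bE bI μ) : Integrable (fun x => ‖x‖) μ.fst := by
  rw [Measure.fst, integrable_map_measure (by fun_prop) (by fun_prop)]
  refine hμ.integrable.mono' (by fun_prop) (Filter.Eventually.of_forall fun z => ?_)
  simp

/-- The first moment of an invariant measure is bounded, with a bound not depending on the
strength of the interaction. -/
lemma IsInvariantMeasure.interaction_mul_moment_le {μ : Measure (E d × E d)}
    (hμ : IsInvariantMeasure γ bE bI μ)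
    (h : Dissipative bE bI K g κ L_K L_g L_I R) {τ : ℝ}
    (hA : EnergyBounds (actL K) γ κ L_K L_g τ) (hLI : (L_I : ℝ) ≤ τ * γ / 6 * √κ) :
    γ⁻¹ * (L_I * ∫ x, ‖x‖ ∂μ.fst) ≤ (driftConst γ τ L_g R ‖g 0‖ ‖bI 0 0‖ +
      τ * γ / 2 * noiseConst γ L_K κ * noiseMean d γ τ) / 2 := by
  have hγ := hA.gamma_pos
  have hτ := hA.tau_pos
  have hκ := hA.kappa_pos
  have hL := hA.L_K_nonneg
  have := hμ.isProbabilityMeasure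
  obtain ⟨Ω, mΩ, P, 𝓕, B, X, V, hP, sol, hlaw⟩ := hμ.stationary
  have hXm : ∀ t, Measurable (X t) := fun t => ((sol.adapted_pos t).mono (𝓕.le t)).measurable
  have hVm : ∀ t, Measurable (V t) := fun t => ((sol.adapted_vel t).mono (𝓕.le t)).measurable
  have hfst : ∀ t, P.map (X t) = μ.fst := fun t => by
    rw [← hlaw t, Measure.fst_map_prodMk (hVm t)]
  -- By stationarity the law of the position is constant in time, so the nonlinear equation is the
  -- frozen one.
  have sol' : IsLangevinSolution γ bE bI (fun _ => μ.fst) 𝓕 P B X V := by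
    have h1 := sol
    rw [IsMeanFieldSolution, funext hfst] at h1
    exact h1
  have hint := hμ.integrable_norm_fst
  set m := ∫ x, ‖x‖ ∂μ.fst with hm
  have hm0 : 0 ≤ m := integral_nonneg fun _ => norm_nonneg _
  obtain ⟨W, J, hJm, hJ0, -, -, hJ2, hpath⟩ := sol'.exists_pathwise_bound hint h hA
    (hLI.trans (by gcongr; norm_num))
  rw [← hm] at hpath
  set C := driftConst γ τ L_g R ‖g 0‖ ‖bI 0 0‖ with hC
  have hC0 : 0 ≤ C := by rw [hC, driftConst]; positivity
  set N := noiseConst γ L_K κ with hN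
  have hN0 : 0 ≤ N := by rw [hN, noiseConst]; positivity
  set j := noiseMean d γ τ with hj
  have hj0 : 0 ≤ j := by rw [hj, noiseMean]; positivity
  have hJ1 : ∀ t, ∫⁻ ω, ENNReal.ofReal (J t ω) ∂P ≤ ENNReal.ofReal j := by
    intro t
    calc ∫⁻ ω, ENNReal.ofReal (J t ω) ∂P
        ≤ ∫⁻ ω, ENNReal.ofReal (1 / 2) * (ENNReal.ofReal (J t ω ^ 2) + 1) ∂P := by
          refine lintegral_mono fun ω => ?_
          rw [← ENNReal.ofReal_one, ← ENNReal.ofReal_add (sq_nonneg _) zero_le_one,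
            ← ENNReal.ofReal_mul (by norm_num)]
          exact ENNReal.ofReal_le_ofReal (by nlinarith [sq_nonneg (J t ω - 1)])
      _ ≤ ENNReal.ofReal (1 / 2) * (ENNReal.ofReal (20 * d / (τ * γ / 2) ^ 2) + 1) := by
          rw [lintegral_const_mul' _ _ ENNReal.ofReal_ne_top,
            lintegral_add_right _ measurable_const, lintegral_one, measure_univ]
          gcongr
          exact hJ2 t
      _ = ENNReal.ofReal j := by
          rw [← ENNReal.ofReal_one, ← ENNReal.ofReal_add (by positivity) zero_le_one,
            ← ENNReal.ofReal_mul (by norm_num), hj, noiseMean]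
          congr 1; ring
  set h0 : Ω → ℝ := fun ω => √(1 + energy (actL K) γ τ (X 0 ω) (V 0 ω)) with hh0
  -- Only a first moment of μ is assumed, which suffices because the pathwise bound is for the
  -- square root of the energy. The value of this expectation is irrelevant, as its coefficient
  -- tends to 0.
  have hfin : ∫⁻ ω, ENNReal.ofReal (h0 ω) ∂P ≠ ⊤ := by
    have h1 : Integrable (fun ω => ‖X 0 ω‖ + ‖V 0 ω‖) P := by
      have h2 := hμ.integrable
      rw [← hlaw 0, integrable_map_measure (by fun_prop)
        ((hXm 0).prodMk (hVm 0)).aemeasurable] at h2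
      exact h2
    have h3 := ((integrable_const (1 : ℝ)).add
      (h1.const_mul ((γ ^ 2)⁻¹ * (L_K + 2) + 1))).lintegral_lt_top
    refine ((lintegral_mono fun ω => ?_).trans_lt h3).ne
    exact ENNReal.ofReal_le_ofReal (hA.sqrt_one_add_energy_le _ _)
  set H0 := (∫⁻ ω, ENNReal.ofReal (h0 ω) ∂P).toReal with hH0
  have hH0' : ∫⁻ ω, ENNReal.ofReal (h0 ω) ∂P = ENNReal.ofReal H0 :=
    (ENNReal.ofReal_toReal hfin).symm
  have hH00 : 0 ≤ H0 := ENNReal.toReal_nonneg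
  set lam := τ * γ / 2 with hlam
  have hlam0 : 0 < lam := by positivity
  have hbound : ∀ t : ℝ≥0, m ≤ γ / √κ *
      (Real.exp (-(lam * t)) * H0 + (C + γ⁻¹ * (L_I * m)) / lam + N * j) := by
    intro t
    have h1 : ENNReal.ofReal m = ∫⁻ ω, ENNReal.ofReal ‖X t ω‖ ∂P := by
      rw [hm, ofReal_integral_eq_lintegral_ofReal hint
        (Filter.Eventually.of_forall fun _ => norm_nonneg _), ← hfst t,
        lintegral_map (by fun_prop) (hXm t)]
    have hx : ∀ᵐ ω ∂P, ENNReal.ofReal ‖X t ω‖ ≤ ENNReal.ofReal (γ / √κ) *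
        (ENNReal.ofReal (Real.exp (-(lam * t))) * ENNReal.ofReal (h0 ω) +
          ENNReal.ofReal ((C + γ⁻¹ * (L_I * m)) / lam) +
          ENNReal.ofReal N * ENNReal.ofReal (J t ω)) := by
      filter_upwards [hpath] with ω hω
      have h2 : ‖X t ω‖ ≤ γ / √κ * √(1 + energy (actL K) γ τ (X t ω) (V t ω - W t ω)) := by
        have he := hA.energy_nonneg (X t ω) (V t ω - W t ω)
        refine abs_le_of_sq_le_sq' ?_ (by positivity) |>.2
        rw [mul_pow, div_pow, Real.sq_sqrt hκ.le, Real.sq_sqrt (by linarith)]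
        refine (hA.norm_pos_sq_le _ (V t ω - W t ω)).trans
          (mul_le_mul_of_nonneg_left ?_ (by positivity))
        linarith
      have hh : 0 ≤ h0 ω := Real.sqrt_nonneg _
      have hJ := hJ0 t ω
      rw [← ENNReal.ofReal_mul (Real.exp_pos _).le, ← ENNReal.ofReal_mul hN0,
        ← ENNReal.ofReal_add (by positivity) (by positivity),
        ← ENNReal.ofReal_add (by positivity) (by positivity),
        ← ENNReal.ofReal_mul (by positivity)]
      refine ENNReal.ofReal_le_ofReal (h2.trans ?_)
      exact mul_le_mul_of_nonneg_left (hω t) (by positivity)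
    have h3 : ENNReal.ofReal m ≤ ENNReal.ofReal (γ / √κ) *
        (ENNReal.ofReal (Real.exp (-(lam * t))) * ENNReal.ofReal H0 +
          ENNReal.ofReal ((C + γ⁻¹ * (L_I * m)) / lam) +
          ENNReal.ofReal N * ENNReal.ofReal j) := by
      rw [h1]
      refine (lintegral_mono_ae hx).trans ?_
      rw [lintegral_const_mul' _ _ ENNReal.ofReal_ne_top,
        lintegral_add_right _ ((hJm t).ennreal_ofReal.const_mul _),
        lintegral_add_right _ measurable_const, lintegral_const_mul' _ _ ENNReal.ofReal_ne_top,
        lintegral_const_mul' _ _ ENNReal.ofReal_ne_top, hH0', lintegral_const, measure_univ,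
        mul_one]
      gcongr
      exact hJ1 t
    rw [← ENNReal.ofReal_mul (Real.exp_pos _).le, ← ENNReal.ofReal_mul hN0,
        ← ENNReal.ofReal_add (by positivity) (by positivity),
        ← ENNReal.ofReal_add (by positivity) (by positivity),
        ← ENNReal.ofReal_mul (by positivity)] at h3
    exact (ENNReal.ofReal_le_ofReal_iff (by positivity)).1 h3
  -- The left side does not depend on t, so the initial term disappears in the limit.
  have hlim : m ≤ γ / √κ * (0 * H0 + (C + γ⁻¹ * (L_I * m)) / lam + N * j) := by
    refine ge_of_tendsto' (x := Filter.atTop) (f := fun n : ℕ => γ / √κ *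
      (Real.exp (-(lam * ((n : ℝ≥0) : ℝ))) * H0 + (C + γ⁻¹ * (L_I * m)) / lam + N * j)) ?_
      fun n => hbound n
    have h1 : Filter.Tendsto (fun n : ℕ => Real.exp (-(lam * ((n : ℝ≥0) : ℝ)))) Filter.atTop
        (nhds 0) := by
      refine Real.tendsto_exp_neg_atTop_nhds_zero.comp ?_
      simpa using Filter.Tendsto.const_mul_atTop hlam0 (tendsto_natCast_atTop_atTop (R := ℝ))
    exact (((h1.mul_const H0).add_const _).add_const _).const_mul _
  rw [zero_mul, zero_add] at hlim
  have hsκ : 0 < √κ := Real.sqrt_pos.2 hκ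
  -- Since L_I ≤ (lam/3)√κ, the bound on m becomes z ≤ (C + z + lam N j)/3. The coefficient of z on
  -- the right is below 1, so z ≤ (C + lam N j)/2, free of L_I and μ.
  set z := γ⁻¹ * (L_I * m) with hz
  have hz1 : z ≤ γ⁻¹ * (lam / 3 * √κ * m) := by
    rw [hz]
    gcongr
    exact hLI.trans (le_of_eq (by rw [hlam]; ring))
  have hz2 : γ⁻¹ * (lam / 3 * √κ * m) ≤ (C + z + lam * N * j) / 3 := by
    calc γ⁻¹ * (lam / 3 * √κ * m)
        ≤ γ⁻¹ * (lam / 3 * √κ * (γ / √κ * ((C + z) / lam + N * j))) := by gcongr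
      _ = (C + z + lam * N * j) / 3 := by field_simp
  linarith

/-- The bound for the second moments of the Markovian equation. -/
noncomputable def secondMomentBound (d : ℕ) (γ κ L_K L_g τ R a b m₀ : ℝ) : ℝ :=
  (γ ^ 2 / κ + 4 * γ ^ 2) * (3 * (1 + ((γ ^ 2)⁻¹ * (L_K + 2) + 1) * m₀
    + ((driftConst γ τ L_g R a b + (driftConst γ τ L_g R a b +
      τ * γ / 2 * noiseConst γ L_K κ * noiseMean d γ τ) / 2) / (τ * γ / 2)) ^ 2
    + noiseConst γ L_K κ ^ 2 * (20 * d / (τ * γ / 2) ^ 2))) + 2 * (20 * d)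

/-- The pathwise bound is squared and integrated, with the contribution of μ replaced by its bound
from `interaction_mul_moment_le`. That is why neither L_I nor μ occurs on the right-hand side. -/
lemma IsMarkovSolution.secondMoment_le [IsProbabilityMeasure P] {μ : Measure (E d × E d)}
    (hμ : IsInvariantMeasure γ bE bI μ) (sol : IsMarkovSolution γ bE bI μ 𝓕 P B Y U)
    (h : Dissipative bE bI K g κ L_K L_g L_I R) {τ : ℝ}
    (hA : EnergyBounds (actL K) γ κ L_K L_g τ) (hLI : (L_I : ℝ) ≤ τ * γ / 6 * √κ)
    {m₀ : ℝ≥0} (hm₀ : secondMoment P Y U 0 = m₀) (t : ℝ≥0) :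
    secondMoment P Y U t ≤
      ENNReal.ofReal (secondMomentBound d γ κ L_K L_g τ R ‖g 0‖ ‖bI 0 0‖ m₀) := by
  have hγ := hA.gamma_pos
  have hτ := hA.tau_pos
  have hκ := hA.kappa_pos
  have hL := hA.L_K_nonneg
  have := hμ.isProbabilityMeasure
  have hint := hμ.integrable_norm_fst
  have hz := hμ.interaction_mul_moment_le h hA hLI
  obtain ⟨W, J, hJm, hJ0, hWm, hW2, hJ2, hpath⟩ :=
    IsLangevinSolution.exists_pathwise_bound hint sol h hA (hLI.trans (by gcongr; norm_num))
  have hYm : ∀ t, Measurable (Y t) := fun t => ((sol.adapted_pos t).mono (𝓕.le t)).measurable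
  have hUm : ∀ t, Measurable (U t) := fun t => ((sol.adapted_vel t).mono (𝓕.le t)).measurable
  have henorm : ∀ x : E d, ‖x‖ₑ ^ 2 = ENNReal.ofReal (‖x‖ ^ 2) := fun x => by
    rw [← ofReal_norm, ENNReal.ofReal_pow (norm_nonneg _)]
  have hsum : ∀ s ω, ‖Y s ω‖ₑ ^ 2 + ‖U s ω‖ₑ ^ 2 =
      ENNReal.ofReal (‖Y s ω‖ ^ 2 + ‖U s ω‖ ^ 2) := fun s ω => by
    rw [henorm, henorm, ENNReal.ofReal_add (sq_nonneg _) (sq_nonneg _)]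
  have hm : ∫⁻ ω, ENNReal.ofReal (‖Y 0 ω‖ ^ 2 + ‖U 0 ω‖ ^ 2) ∂P = ENNReal.ofReal m₀ := by
    rw [ENNReal.ofReal_coe_nnreal, ← hm₀, secondMoment]
    simp_rw [hsum]
  rw [secondMomentBound]
  set C := driftConst γ τ L_g R ‖g 0‖ ‖bI 0 0‖ with hC
  have hC0 : 0 ≤ C := by rw [hC, driftConst]; positivity
  set N := noiseConst γ L_K κ with hN
  have hN0 : 0 ≤ N := by rw [hN, noiseConst]; positivity
  set j := noiseMean d γ τ with hj
  have hj0 : 0 ≤ j := by rw [hj, noiseMean]; positivity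
  set z := γ⁻¹ * (L_I * ∫ x, ‖x‖ ∂μ.fst) with hzdef
  have hz0 : 0 ≤ z := by
    have : 0 ≤ ∫ x, ‖x‖ ∂μ.fst := integral_nonneg fun _ => norm_nonneg _
    positivity
  set lam := τ * γ / 2 with hlam
  have hlam0 : 0 < lam := by positivity
  set D := (C + (C + lam * N * j) / 2) / lam with hD
  have hD0 : 0 ≤ D := by positivity
  set c := (γ ^ 2)⁻¹ * (L_K + 2) + 1 with hc
  have hc0 : 0 ≤ c := by positivity
  have hCz : (C + z) / lam ≤ D := by
    rw [hD]
    gcongr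
  have hpt : ∀ᵐ ω ∂P, ‖Y t ω‖ₑ ^ 2 + ‖U t ω‖ₑ ^ 2 ≤
      ENNReal.ofReal (γ ^ 2 / κ + 4 * γ ^ 2) * (ENNReal.ofReal 3 *
        (ENNReal.ofReal 1 + ENNReal.ofReal c * ENNReal.ofReal (‖Y 0 ω‖ ^ 2 + ‖U 0 ω‖ ^ 2)
          + ENNReal.ofReal (D ^ 2) + ENNReal.ofReal (N ^ 2) * ENNReal.ofReal (J t ω ^ 2)))
        + ENNReal.ofReal 2 * ENNReal.ofReal (‖W t ω‖ ^ 2) := by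
    filter_upwards [hpath] with ω hω
    rw [hsum, ← ENNReal.ofReal_mul hc0, ← ENNReal.ofReal_mul (by positivity),
      ← ENNReal.ofReal_mul (by norm_num), ← ENNReal.ofReal_add (by positivity) (by positivity),
      ← ENNReal.ofReal_add (by positivity) (by positivity),
      ← ENNReal.ofReal_add (by positivity) (by positivity),
      ← ENNReal.ofReal_mul (by norm_num), ← ENNReal.ofReal_mul (by positivity),
      ← ENNReal.ofReal_add (by positivity) (by positivity)]
    refine ENNReal.ofReal_le_ofReal ?_
    set e := energy (actL K) γ τ (Y t ω) (U t ω - W t ω) with he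
    set e0 := energy (actL K) γ τ (Y 0 ω) (U 0 ω) with he0
    have hepos : 0 ≤ e := hA.energy_nonneg _ _
    have he0pos : 0 ≤ e0 := hA.energy_nonneg _ _
    have he0le : e0 ≤ c * (‖Y 0 ω‖ ^ 2 + ‖U 0 ω‖ ^ 2) := hA.energy_le _ _
    have hJ := hJ0 t ω
    have h1 : √(1 + e) ≤ √(1 + e0) + D + N * J t ω := by
      refine (hω t).trans ?_
      have h2 : Real.exp (-(lam * t)) ≤ 1 := Real.exp_le_one_iff.2 (by
        have : 0 ≤ lam * (t : ℝ) := by positivity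
        linarith)
      have h3 := mul_le_mul_of_nonneg_right h2 (Real.sqrt_nonneg (1 + e0))
      linarith
    have h4 : 1 + e ≤ 3 * (1 + c * (‖Y 0 ω‖ ^ 2 + ‖U 0 ω‖ ^ 2) + D ^ 2
        + N ^ 2 * J t ω ^ 2) := by
      have h5 := pow_le_pow_left₀ (Real.sqrt_nonneg _) h1 2
      rw [Real.sq_sqrt (by linarith)] at h5
      have h6 : √(1 + e0) ^ 2 = 1 + e0 := Real.sq_sqrt (by linarith)
      set r := √(1 + e0)
      have h7 : (r + D + N * J t ω) ^ 2 ≤ 3 * (r ^ 2 + D ^ 2 + (N * J t ω) ^ 2) := by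
        linarith [sq_nonneg (r - D), sq_nonneg (r - N * J t ω), sq_nonneg (D - N * J t ω)]
      rw [mul_pow] at h7
      linarith
    -- The position costs γ²/κ times the energy. The velocity costs 4γ² times the energy plus 2‖W‖²,
    -- since ‖U‖² ≤ 2‖U - W‖² + 2‖W‖². This gives the prefactor in `secondMomentBound`.
    have h8 := hA.norm_pos_sq_le (Y t ω) (U t ω - W t ω)
    have h9 := hA.norm_vel_sq_le (Y t ω) (U t ω - W t ω)
    have h10 : ‖U t ω‖ ^ 2 ≤ 2 * ‖U t ω - W t ω‖ ^ 2 + 2 * ‖W t ω‖ ^ 2 := by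
      have h11 : ‖U t ω‖ ≤ ‖U t ω - W t ω‖ + ‖W t ω‖ := by
        simpa using norm_add_le (U t ω - W t ω) (W t ω)
      have h12 := pow_le_pow_left₀ (norm_nonneg _) h11 2
      linarith [sq_nonneg (‖U t ω - W t ω‖ - ‖W t ω‖)]
    have h13 := mul_le_mul_of_nonneg_left ((le_add_of_nonneg_left zero_le_one).trans h4)
      (by positivity : 0 ≤ γ ^ 2 / κ + 4 * γ ^ 2)
    rw [← he] at h8 h9
    linarith
  calc secondMoment P Y U t ≤ _ := lintegral_mono_ae hpt
    _ ≤ ENNReal.ofReal (γ ^ 2 / κ + 4 * γ ^ 2) * (ENNReal.ofReal 3 *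
        (ENNReal.ofReal 1 + ENNReal.ofReal c * ENNReal.ofReal m₀
          + ENNReal.ofReal (D ^ 2) + ENNReal.ofReal (N ^ 2) *
            ENNReal.ofReal (20 * d / lam ^ 2)))
        + ENNReal.ofReal 2 * ENNReal.ofReal (20 * d) := by
      rw [lintegral_add_right _ (((hWm t).norm.pow_const 2).ennreal_ofReal.const_mul _),
        lintegral_const_mul' _ _ ENNReal.ofReal_ne_top,
        lintegral_const_mul' _ _ ENNReal.ofReal_ne_top,
        lintegral_const_mul' _ _ ENNReal.ofReal_ne_top,
        lintegral_add_right _ (((hJm t).pow_const 2).ennreal_ofReal.const_mul _),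
        lintegral_add_right _ measurable_const, lintegral_add_left measurable_const,
        lintegral_const_mul' _ _ ENNReal.ofReal_ne_top,
        lintegral_const_mul' _ _ ENNReal.ofReal_ne_top, hm, lintegral_const, lintegral_const,
        measure_univ, mul_one, mul_one]
      gcongr
      · exact hJ2 t
      · exact hW2 t
    _ = _ := by
      rw [← ENNReal.ofReal_mul hc0, ← ENNReal.ofReal_mul (by positivity),
      ← ENNReal.ofReal_mul (by norm_num), ← ENNReal.ofReal_add (by positivity) (by positivity),
      ← ENNReal.ofReal_add (by positivity) (by positivity),
      ← ENNReal.ofReal_add (by positivity) (by positivity),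
      ← ENNReal.ofReal_mul (by norm_num), ← ENNReal.ofReal_mul (by positivity),
      ← ENNReal.ofReal_add (by positivity) (by positivity)]

end Solutions

end LangevinMoment

/-- The order of quantifiers expresses the dependence of the constant: M₂ is fixed before the
coefficients, L_I and μ, and g and bI influence it only through a and b. -/
theorem proposition4p1 (d : ℕ) (γ L_K κ R a b : ℝ) (L_g m₀ : ℝ≥0) (hγ : 0 < γ) :
    ∃ M₂ : ℝ≥0, 0 < M₂ ∧
      ∀ (bE : LangevinMoment.E d → LangevinMoment.E d)
        (bI : LangevinMoment.E d → LangevinMoment.E d → LangevinMoment.E d)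
        (K : Matrix (Fin d) (Fin d) ℝ) (g : LangevinMoment.E d → LangevinMoment.E d) (L_I : ℝ≥0)
        (μ : Measure (LangevinMoment.E d × LangevinMoment.E d)),
        LangevinMoment.Dissipative bE bI K g κ L_K L_g L_I R →
        (L_g : ℝ) < γ * √(κ / 2) →
        (L_I : ℝ) ≤ LangevinMoment.interactionBound K γ κ L_K L_g R →
        ‖g 0‖ = a → ‖bI 0 0‖ = b →
        LangevinMoment.IsInvariantMeasure γ bE bI μ →
        ∀ (Ω : Type*) (mΩ : MeasurableSpace Ω) (P : Measure Ω) [IsProbabilityMeasure P]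
          (𝓕 : Filtration ℝ≥0 mΩ) (B Y U : ℝ≥0 → Ω → LangevinMoment.E d),
          LangevinMoment.IsMarkovSolution γ bE bI μ 𝓕 P B Y U →
          LangevinMoment.secondMoment P Y U 0 = m₀ →
          (⨆ t : ℝ≥0, LangevinMoment.secondMoment P Y U t) ≤ (M₂ : ℝ≥0∞) := by
  -- Adding 1 makes the constant positive for all parameter values, including those for which the
  -- hypotheses cannot hold and the formula may be negative.
  refine ⟨(LangevinMoment.secondMomentBound d γ κ L_K L_g (LangevinMoment.tau γ κ L_g) R a b
    m₀).toNNReal + 1, by positivity, ?_⟩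
  rintro bE bI K g L_I μ h hLg hLI rfl rfl hμ Ω mΩ P _ 𝓕 B Y U sol hm₀
  refine iSup_le fun t => ?_
  refine (sol.secondMoment_le hμ h (h.energyBounds hγ hLg) (h.interaction_le hγ hLg hLI) hm₀
    t).trans ?_
  rw [ENNReal.ofReal, ENNReal.coe_le_coe]
  exact le_self_add
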